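/- Let $F$ be a field of characteristic different from $2$ and $3$, and let $\mathfrak g$ be a split Lie algebra of type $D_4$ over $F$ (the Lie algebra of a split group $G$ of type $D_4$) with a fixed Chevalley basis consisting of root vectors $x_\beta$ and of the coroots $h_i=[x_{\alpha_i},x_{-\alpha_i}]$ of the simple roots. Let $\alpha$ be the simple root at the central node of the Dynkin diagram, $\rho$ the highest root, and let $\mathfrak g=\bigoplus_{k=-2}^{2}\mathfrak g_k$ be the grading in which $x_\beta$ has as degree the coefficient of $\alpha$ in $\beta$ and the $h_i$ have degree $0$. On the $8$-dimensional space $\mathfrak g_1$ define the skew-symmetric bilinear form $\langle -,-\rangle$ and the quartic form $q$ by $$[v,w]=\langle v,w\rangle\, x_\rho,\qquad (\operatorname{ad} v)^4(x_{-\rho})=q(v)\,x_\rho\qquad (v,w\in\mathfrak g_1).$$ Let $\mathrm{Stab}(q,\langle -,-\rangle)$ be the algebraic group over $F$ of all elements of $\mathrm{GL}(\mathfrak g_1)$ that preserve both $q$ and $\langle-,-\rangle$. Then $\mathrm{Stab}(q,\langle -,-\rangle)$ is $\mathrm{SL}_2^3\rtimes S_3$, acting on $\mathfrak g_1$ as follows: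 the three factors $\mathrm{SL}_2$ correspond to the three simple roots $\alpha_i\neq\alpha$, and $\begin{pmatrix}1&t\\0&1\end{pmatrix}$ and $\begin{pmatrix}1&0\\t&1\end{pmatrix}$ in the $i$-th factor act as $\exp(t\operatorname{ad}x_{\alpha_i})$ and $\exp(t\operatorname{ad}x_{-\alpha_i})$; the group $S_3$ permutes the three factors and acts by the diagram automorphisms of $\mathfrak g$, i.e. the automorphisms that permute the $x_{\alpha_i}$ with $\alpha_i\ne\alpha$, permute the $x_{-\alpha_i}$ in the same way, and fix $x_{\pm\alpha}$. In precise terms, for every algebraically closed field $K\supseteq F$ this prescription defines a homomorphism $\Phi\colon \mathrm{SL}_2(K)^3\rtimes S_3\to \mathrm{GL}(\mathfrak g_1\otimes_F K)$; its image is the group of all elements of $\mathrm{GL}(\mathfrak g_1\otimes_F K)$ that preserve the quartic form and the bilinear form; and its kernel is $\{(\varepsilon_1 I,\varepsilon_2 I,\varepsilon_3 I):\varepsilon_i=\pm1,\ \varepsilon_1\varepsilon_2\varepsilon_3=1\}\subseteq \mathrm{SL}_2(K)^3$ (so that the stabilizer is the semidirect product of the image of $\mathrm{SL}_2(K)^3$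 and of $S_3$). Moreover, an element $g\in\mathrm{GL}(\mathfrak g_1)$ preserves both $q$ and $\langle-,-\rangle$ if and only if $g\otimes K$ lies in the image of $\Phi$. -/

import Mathlib

open scoped TensorProduct

/-- The root system of type `D₄`.  An element of the root lattice is written through its
coefficients on the simple roots `α₀, α₁, α₂, α₃`, where `α₁` is the central node of the Dynkin
diagram; the inner product is given by the Cartan matrix, and the roots are the vectors of the
root lattice of squared length `2`. -/
def RootD4 : Type :=
  {β : Fin 4 → ℤ // β ⬝ᵥ (CartanMatrix.D 4).mulVec β = 2}

namespace RootD4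

/-- The coefficients of a root on the simple roots. -/
def coeff (β : RootD4) : Fin 4 → ℤ := β.1

/-- The pairing `⟨β, γ⟩ = 2 (β, γ) / (γ, γ)`, which is `(β, γ)` since all roots have squared
length `2`. -/
def pairing (β γ : RootD4) : ℤ := β.coeff ⬝ᵥ (CartanMatrix.D 4).mulVec γ.coeff

/-- The opposite root. -/
def opp (β : RootD4) : RootD4 :=
  ⟨-β.coeff, by simpa [coeff, Matrix.mulVec_neg] using β.2⟩

/-- The simple roots. -/
def simple (i : Fin 4) : RootD4 := ⟨Pi.single i 1, by revert i; decide⟩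

/-- The highest root `ρ = α₀ + 2 α₁ + α₂ + α₃`. -/
def rho : RootD4 := ⟨![1, 2, 1, 1], by decide⟩

/-- The `α`-height of a root, for `α = α₁`: its coefficient on `α`. -/
def height (β : RootD4) : ℤ := β.coeff 1

theorem height_eq_pairing_rho (β : RootD4) : β.height = β.pairing rho := by
  have : (CartanMatrix.D 4).mulVec rho.coeff = ![0, 1, 0, 0] := by decide
  simp [height, pairing, this, dotProduct, Fin.sum_univ_four]

theorem eq_rho_of_height (β : RootD4) (h : β.height = 2) : β = rho := by
  obtain ⟨b, hb⟩ := β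
  simp only [height, coeff] at h
  simp only [dotProduct, Matrix.mulVec, CartanMatrix.D_four, Fin.sum_univ_four] at hb
  simp at hb
  have hs : (b 0 - 1) ^ 2 + (b 2 - 1) ^ 2 + (b 3 - 1) ^ 2 = 0 := by
    rw [h] at hb
    linarith
  have h0 : b 0 - 1 = 0 := by
    apply pow_eq_zero_iff (two_ne_zero) |>.1
    nlinarith [sq_nonneg (b 0 - 1), sq_nonneg (b 2 - 1), sq_nonneg (b 3 - 1)]
  have h2 : b 2 - 1 = 0 := by
    apply pow_eq_zero_iff (two_ne_zero) |>.1
    nlinarith [sq_nonneg (b 0 - 1), sq_nonneg (b 2 - 1), sq_nonneg (b 3 - 1)]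
  have h3 : b 3 - 1 = 0 := by
    apply pow_eq_zero_iff (two_ne_zero) |>.1
    nlinarith [sq_nonneg (b 0 - 1), sq_nonneg (b 2 - 1), sq_nonneg (b 3 - 1)]
  apply Subtype.ext
  funext i
  fin_cases i <;> simp [rho] <;> linarith

end RootD4

/-- A Chevalley basis of type `D₄` of a Lie algebra `L` over a field `F`: a basis consisting of
`h₀, …, h₃` (the coroots of the simple roots) and of root vectors `x_β`, one for each root `β`,
with the usual multiplication table.  A Lie algebra with such a basis is a split Lie algebra of
type `D₄` over `F`. -/
structure ChevalleyBasisD4 (F L : Type*) [Field F] [LieRing L] [LieAlgebra F L] where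
  /-- The basis; `Sum.inl i` indexes `hᵢ` and `Sum.inr β` indexes `x_β`. -/
  basis : Module.Basis (Fin 4 ⊕ RootD4) F L
  /-- The structure constants `c_{β,γ}` (only their values for `β + γ` a root matter). -/
  c : RootD4 → RootD4 → ℤ
  lie_h_h : ∀ i j, ⁅basis (Sum.inl i), basis (Sum.inl j)⁆ = 0
  lie_h_x : ∀ i β, ⁅basis (Sum.inl i), basis (Sum.inr β)⁆ =
    (β.pairing (RootD4.simple i) : F) • basis (Sum.inr β)
  /-- `[x_β, x_{-β}]` is the coroot `h_β = ∑ᵢ nᵢ hᵢ` of `β = ∑ᵢ nᵢ αᵢ`. -/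
  lie_x_opp : ∀ β : RootD4, ⁅basis (Sum.inr β), basis (Sum.inr β.opp)⁆ =
    ∑ i, (β.coeff i : F) • basis (Sum.inl i)
  lie_x_x : ∀ β γ δ : RootD4, β.coeff + γ.coeff = δ.coeff →
    ⁅basis (Sum.inr β), basis (Sum.inr γ)⁆ = (c β γ : F) • basis (Sum.inr δ)
  lie_x_x_zero : ∀ β γ : RootD4, β.coeff + γ.coeff ≠ 0 →
    (∀ δ : RootD4, β.coeff + γ.coeff ≠ δ.coeff) → ⁅basis (Sum.inr β), basis (Sum.inr γ)⁆ = 0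
  c_unit : ∀ β γ δ : RootD4, β.coeff + γ.coeff = δ.coeff → c β γ = 1 ∨ c β γ = -1
  c_opp : ∀ β γ δ : RootD4, β.coeff + γ.coeff = δ.coeff → c β γ = -c β.opp γ.opp

namespace ChevalleyBasisD4

section Basic

variable {F L : Type*} [Field F] [LieRing L] [LieAlgebra F L] (C : ChevalleyBasisD4 F L)

/-- The root vector `x_β`. -/
noncomputable def x (β : RootD4) : L := C.basis (Sum.inr β)

/-- The degrees of the elements of the Chevalley basis. -/
def degree : Fin 4 ⊕ RootD4 → ℤ
  | Sum.inl _ => 0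
  | Sum.inr β => β.height

/-- The grading `L = L₋₂ ⊕ L₋₁ ⊕ L₀ ⊕ L₁ ⊕ L₂` by `α`-height: `L_k` is spanned by the `x_β` with
`β` of `α`-height `k`, together with the `hᵢ` if `k = 0`. -/
noncomputable def grade (k : ℤ) : Submodule F L :=
  Submodule.span F (C.basis '' {j | degree j = k})

/-- The space `𝔤₁`. -/
noncomputable abbrev g₁ : Submodule F L := C.grade 1

/-- The skew-symmetric bilinear form on `𝔤₁`, with `[v, w] = ⟨v, w⟩ x_ρ`
(see `lie_eq_bilin_smul`). -/
noncomputable def bilin (v w : C.g₁) : F :=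
  C.basis.coord (Sum.inr RootD4.rho) ⁅(v : L), (w : L)⁆

/-- The quartic form on `𝔤₁`, with `(ad v)⁴ x_{-ρ} = q(v) x_ρ` (see `ad_pow_four_eq_quartic_smul`).
-/
noncomputable def quartic (v : C.g₁) : F :=
  C.basis.coord (Sum.inr RootD4.rho) ((LieAlgebra.ad F L (v : L) ^ 4) (C.x RootD4.rho.opp))

theorem lie_basis_mem (j k : Fin 4 ⊕ RootD4) :
    ⁅C.basis j, C.basis k⁆ ∈ C.grade (degree j + degree k) := by
  have mem : ∀ (l : Fin 4 ⊕ RootD4) (n : ℤ), degree l = n → C.basis l ∈ C.grade n :=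
    fun l n h => Submodule.subset_span ⟨l, h, rfl⟩
  rcases j with i | β <;> rcases k with j | γ
  · rw [C.lie_h_h]; exact Submodule.zero_mem _
  · rw [C.lie_h_x]; exact Submodule.smul_mem _ _ (mem _ _ (by simp [degree]))
  · rw [← lie_skew, C.lie_h_x]
    exact Submodule.neg_mem _ (Submodule.smul_mem _ _ (mem _ _ (by simp [degree])))
  · by_cases h0 : β.coeff + γ.coeff = 0
    · have hγ : γ = β.opp := Subtype.ext (eq_neg_of_add_eq_zero_right h0)
      have h1 : degree (Sum.inr β) + degree (Sum.inr γ) = 0 := congrFun h0 1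
      rw [h1, hγ, C.lie_x_opp]
      exact Submodule.sum_mem _ fun i _ => Submodule.smul_mem _ _ (mem _ _ rfl)
    · by_cases h : ∃ δ : RootD4, β.coeff + γ.coeff = δ.coeff
      · obtain ⟨δ, hδ⟩ := h
        rw [C.lie_x_x β γ δ hδ]
        exact Submodule.smul_mem _ _ (mem _ _ (congrFun hδ 1).symm)
      · rw [C.lie_x_x_zero β γ h0 (by simpa using h)]
        exact Submodule.zero_mem _

theorem lie_mem {k l : ℤ} {v w : L} (hv : v ∈ C.grade k) (hw : w ∈ C.grade l) :
    ⁅v, w⁆ ∈ C.grade (k + l) := by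
  induction hv using Submodule.span_induction with
  | mem v hv =>
    induction hw using Submodule.span_induction with
    | mem w hw =>
      obtain ⟨i, rfl, rfl⟩ := hv
      obtain ⟨j, rfl, rfl⟩ := hw
      exact C.lie_basis_mem i j
    | zero => simp
    | add a b _ _ ha hb => rw [lie_add]; exact Submodule.add_mem _ ha hb
    | smul t a _ ha => rw [lie_smul]; exact Submodule.smul_mem _ _ ha
  | zero => simp
  | add a b _ _ ha hb => rw [add_lie]; exact Submodule.add_mem _ ha hb
  | smul t a _ ha => rw [smul_lie]; exact Submodule.smul_mem _ _ ha

theorem eq_coord_smul {v : L} (hv : v ∈ C.grade 2) :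
    v = C.basis.coord (Sum.inr RootD4.rho) v • C.x RootD4.rho := by
  induction hv using Submodule.span_induction with
  | mem v hv =>
    obtain ⟨j, hj, rfl⟩ := hv
    rcases j with i | β
    · simp [degree] at hj
    · rw [RootD4.eq_rho_of_height β hj]
      simp [x]
  | zero => simp
  | add a b _ _ ha hb => rw [map_add, add_smul, ← ha, ← hb]
  | smul t a _ ha => rw [map_smul, smul_assoc, ← ha]

theorem lie_eq_bilin_smul (v w : C.g₁) : ⁅(v : L), (w : L)⁆ = C.bilin v w • C.x RootD4.rho := by
  have h := C.lie_mem v.2 w.2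
  rw [show (1 : ℤ) + 1 = 2 by norm_num] at h
  exact C.eq_coord_smul h

theorem ad_pow_four_eq_quartic_smul (v : C.g₁) :
    (LieAlgebra.ad F L (v : L) ^ 4) (C.x RootD4.rho.opp) = C.quartic v • C.x RootD4.rho := by
  have h0 : C.x RootD4.rho.opp ∈ C.grade (-2) := Submodule.subset_span ⟨_, rfl, rfl⟩
  have h := C.lie_mem v.2 (C.lie_mem v.2 (C.lie_mem v.2 (C.lie_mem v.2 h0)))
  rw [show (1 : ℤ) + (1 + (1 + (1 + -2))) = 2 by norm_num] at h
  have e : (LieAlgebra.ad F L (v : L) ^ 4) (C.x RootD4.rho.opp) =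
      ⁅(v : L), ⁅(v : L), ⁅(v : L), ⁅(v : L), C.x RootD4.rho.opp⁆⁆⁆⁆ := by
    simp only [pow_succ, pow_zero, one_mul, Module.End.mul_apply, LieAlgebra.ad_apply]
  have h2 := C.eq_coord_smul h
  rw [← e] at h2
  exact h2

/-- `Stab(q, ⟨-,-⟩)`: the subgroup of `GL(𝔤₁)` that stabilizes both the quartic form and the
bilinear form. -/
noncomputable def stab : Subgroup (C.g₁ ≃ₗ[F] C.g₁) where
  carrier := {g | (∀ v, C.quartic (g v) = C.quartic v) ∧
    ∀ v w, C.bilin (g v) (g w) = C.bilin v w}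
  mul_mem' {a b} ha hb := ⟨fun v => by rw [LinearEquiv.mul_apply, ha.1, hb.1],
    fun v w => by rw [LinearEquiv.mul_apply, LinearEquiv.mul_apply, ha.2, hb.2]⟩
  one_mem' := ⟨fun _ => rfl, fun _ _ => rfl⟩
  inv_mem' {a} ha := ⟨fun v => by
      have h := ha.1 (a⁻¹ v)
      rwa [← LinearEquiv.mul_apply, mul_inv_cancel, LinearEquiv.coe_one, id_eq, eq_comm] at h,
    fun v w => by
      have h := ha.2 (a⁻¹ v) (a⁻¹ w)
      rwa [← LinearEquiv.mul_apply, ← LinearEquiv.mul_apply, mul_inv_cancel,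
        LinearEquiv.coe_one, id_eq, id_eq, eq_comm] at h⟩

/-- `exp (t ad x_β)` applied to `v`; the exponential series stops here because `(ad x_β)³ = 0`. -/
noncomputable def expAd (β : RootD4) (t : F) (v : L) : L :=
  v + t • ⁅C.x β, v⁆ + (t ^ 2 / 2) • ⁅C.x β, ⁅C.x β, v⁆⁆

/-- The outer nodes of the Dynkin diagram, i.e. the simple roots other than `α = α₁`. -/
abbrev Outer : Type := {i : Fin 4 // i ≠ 1}

/-- `θ` is the diagram automorphism of `L` attached to a permutation `σ` of the outer nodes:
the automorphism that permutes the root vectors of the simple roots, and those of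
their negatives, by `σ` (and fixes the ones of `±α`). -/
def IsDiagramAut (σ : Equiv.Perm Outer) (θ : L ≃ₗ⁅F⁆ L) : Prop :=
  (∀ i : Outer, θ (C.x (RootD4.simple i)) = C.x (RootD4.simple (σ i)) ∧
    θ (C.x (RootD4.simple i).opp) = C.x (RootD4.simple (σ i)).opp) ∧
  θ (C.x (RootD4.simple 1)) = C.x (RootD4.simple 1) ∧
  θ (C.x (RootD4.simple 1).opp) = C.x (RootD4.simple 1).opp

/-- The group `SL₂(F)³`, with one factor for each outer node. -/
abbrev SL2Cubed (F : Type*) [Field F] : Type _ :=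
  Outer → Matrix.SpecialLinearGroup (Fin 2) F

/-- The group `SL₂(F)³ ⋊ S₃`, where `S₃` permutes the three factors. -/
abbrev SL2CubedS3 (F : Type*) [Field F] : Type _ :=
  SL2Cubed F ⋊[mulAutArrow] Equiv.Perm Outer

/-- The upper unitriangular matrix `!![1, t; 0, 1]`. -/
def upper (t : F) : Matrix.SpecialLinearGroup (Fin 2) F := ⟨!![1, t; 0, 1], by simp⟩

/-- The lower unitriangular matrix `!![1, 0; t, 1]`. -/
def lower (t : F) : Matrix.SpecialLinearGroup (Fin 2) F := ⟨!![1, 0; t, 1], by simp⟩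

/-- `Φ` is the natural action of `SL₂(F)³ ⋊ S₃` on `𝔤₁`: the `i`-th factor `SL₂(F)` acts through
the root subgroups of `±αᵢ`, by `exp (± t ad x_{±αᵢ})`, and `S₃` acts by the diagram automorphisms
of `L`.  Since unitriangular matrices generate `SL₂(F)` and the root vectors of the simple
roots and of their negatives generate `L`, there is at most one such `Φ`. -/
structure IsNaturalAction (Φ : SL2CubedS3 F →* (C.g₁ ≃ₗ[F] C.g₁)) : Prop where
  map_upper : ∀ (i : Outer) (t : F) (v : C.g₁),
    (Φ (SemidirectProduct.inl (Pi.mulSingle i (upper t))) v : L) =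
      C.expAd (RootD4.simple i) t v
  map_lower : ∀ (i : Outer) (t : F) (v : C.g₁),
    (Φ (SemidirectProduct.inl (Pi.mulSingle i (lower t))) v : L) =
      C.expAd (RootD4.simple i).opp t v
  map_perm : ∀ σ : Equiv.Perm Outer, ∃ θ : L ≃ₗ⁅F⁆ L, C.IsDiagramAut σ θ ∧
    ∀ v : C.g₁, (Φ (SemidirectProduct.inr σ) v : L) = θ v

end Basic

section BaseChange

variable {F L : Type*} [Field F] [LieRing L] [LieAlgebra F L] (C : ChevalleyBasisD4 F L)
variable (K : Type*) [Field K] [Algebra F K]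

/-- The Chevalley basis `1 ⊗ hᵢ`, `1 ⊗ x_β` of `K ⊗ L` for a field extension `K` of `F`. -/
noncomputable def baseChange : ChevalleyBasisD4 K (K ⊗[F] L) where
  basis := C.basis.baseChange K
  c := C.c
  lie_h_h i j := by
    simp [LieAlgebra.ExtendScalars.bracket_tmul, C.lie_h_h]
  lie_h_x i β := by
    simp only [Module.Basis.baseChange_apply, LieAlgebra.ExtendScalars.bracket_tmul, C.lie_h_x,
      mul_one, TensorProduct.tmul_smul]
    rw [Int.cast_smul_eq_zsmul, Int.cast_smul_eq_zsmul]
  lie_x_opp β := by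
    simp only [Module.Basis.baseChange_apply, LieAlgebra.ExtendScalars.bracket_tmul, C.lie_x_opp,
      mul_one, TensorProduct.tmul_sum, TensorProduct.tmul_smul, Int.cast_smul_eq_zsmul]
  lie_x_x β γ δ h := by
    simp only [Module.Basis.baseChange_apply, LieAlgebra.ExtendScalars.bracket_tmul,
      C.lie_x_x β γ δ h, mul_one, TensorProduct.tmul_smul, Int.cast_smul_eq_zsmul]
  lie_x_x_zero β γ h0 h := by
    simp [LieAlgebra.ExtendScalars.bracket_tmul, C.lie_x_x_zero β γ h0 h]
  c_unit := C.c_unit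
  c_opp := C.c_opp

theorem one_tmul_mem (v : C.g₁) : (1 : K) ⊗ₜ[F] (v : L) ∈ (C.baseChange K).g₁ := by
  obtain ⟨v, hv⟩ := v
  induction hv using Submodule.span_induction with
  | mem v hv =>
    obtain ⟨j, hj, rfl⟩ := hv
    exact Submodule.subset_span ⟨j, hj, by simp [baseChange]⟩
  | zero => simp
  | add a b _ _ ha hb =>
    simp only [TensorProduct.tmul_add]
    exact Submodule.add_mem _ ha hb
  | smul t a _ ha =>
    simp only [TensorProduct.tmul_smul]
    rw [← algebraMap_smul K t]
    exact Submodule.smul_mem _ _ ha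

/-- The element `1 ⊗ v` of the degree one part of `K ⊗ L`, for `v ∈ 𝔤₁`. -/
noncomputable def extend (v : C.g₁) : (C.baseChange K).g₁ := ⟨1 ⊗ₜ[F] (v : L), C.one_tmul_mem K v⟩

end BaseChange

end ChevalleyBasisD4

/-!
The proof identifies `𝔤₁` with a space of `2 × 2 × 2` tensors and determines the linear maps that
preserve the two classical invariants of such tensors.

*Normal form of the basis.* The ratio of the structure constants of a Chevalley basis and the
bimultiplicative signs `RootD4.eps` is a cocycle of signs, hence a coboundary
(`RootD4.IsCocycle.exists_eq_coboundary`). So after multiplication of the root vectors by signs,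
trivial on the simple roots, the structure constants become `eps` (`exists_sign`). These signs are
invariant under the permutations of the outer nodes, so that the diagram automorphisms simply
permute the rescaled root vectors (`IsNormalizing.diagramAut`).

*The forms.* The eight roots of degree one are indexed by three bits, one for each outer node, and
the rescaled root vectors identify `𝔤₁` with `k² ⊗ k² ⊗ k²`. The exponentials of the outer root
vectors become unitriangular matrices acting on the factors, and the diagram automorphisms permute
the factors. The form `⟨-, -⟩` becomes, up to a sign, the tensor product of the three symplectic
forms, and `q` becomes `6` times Cayley's hyperdeterminant (`IsNormalizing.bilin_eq`,
`IsNormalizing.quartic_eq`).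

*The stabilizer.* In characteristic other than `2`, a tensor `v` is pure if and only if
`q(w + v) + q(w - v) - 2 q(w) - 2 q(v) = 2 ⟨v, w⟩²` for all `w`, where `q` is now the
hyperdeterminant (`isPure_iff`). A linear map `g` that preserves both forms therefore preserves the
pure tensors. Writing the images of the opposite basis tensors `e_0` and `e_1` as products of
vectors gives a map `⨂ A i` with the same values there, so that `g` may be assumed to fix `e_0` and
`e_1`. Purity then forces `g` to permute, up to scalars, the three basis tensors adjacent to each of
them, and `g` is a permutation of the factors composed with diagonal matrices. Hence
`g = (⨂ A i) ∘ σ` with `∏ det (A i) = 1` (`exists_eq_tensorMap_mul_permMap`). Over an algebraically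
closed field, square roots of the determinants allow each `A i` to be scaled into `SL₂` without
changing `⨂ A i`. An element of the stabilizer over `F` is first decomposed over `F`, and the
matrices are then extended to `K`; the converse holds because both forms are compatible with
extension of scalars. The kernel is read off from the entries of `⨂ A i`
(`tensorAction_eq_one_iff`).
-/

/-! ### The roots of type `D₄` -/

namespace RootD4

instance : DecidableEq RootD4 :=
  inferInstanceAs (DecidableEq {β : Fin 4 → ℤ // β ⬝ᵥ (CartanMatrix.D 4).mulVec β = 2})

theorem pairing_eq (β γ : RootD4) : β.pairing γ =
    2 * ∑ i, β.coeff i * γ.coeff i + 2 * (β.coeff 1 * γ.coeff 1)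
      - β.coeff 1 * ∑ i, γ.coeff i - γ.coeff 1 * ∑ i, β.coeff i := by
  simp only [pairing, dotProduct, Matrix.mulVec, CartanMatrix.D_four, Fin.sum_univ_four]
  simp
  ring

theorem pairing_self (β : RootD4) : β.pairing β = 2 := β.2

theorem coeff_injective : Function.Injective coeff := fun _ _ h => Subtype.ext h

/-- The positive roots, in order of increasing height. -/
def pos : Fin 12 → RootD4 :=
  ![simple 0, simple 1, simple 2, simple 3,
    ⟨![1, 1, 0, 0], by decide⟩, ⟨![0, 1, 1, 0], by decide⟩, ⟨![0, 1, 0, 1], by decide⟩,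
    ⟨![1, 1, 1, 0], by decide⟩, ⟨![1, 1, 0, 1], by decide⟩, ⟨![0, 1, 1, 1], by decide⟩,
    ⟨![1, 1, 1, 1], by decide⟩, rho]

/-- Every root is positive or the opposite of a positive root; in particular there are finitely
many roots, so that statements about all roots become decidable. -/
theorem exists_pos_eq_or (β : RootD4) : (∃ k, pos k = β) ∨ ∃ k, pos k = β.opp := by
  have h := β.pairing_self
  rw [pairing_eq] at h
  simp only [Fin.sum_univ_four] at h
  -- the roots with coefficients in `[-2, 2]` are found by inspection
  have key : ∀ a ∈ Finset.Icc (-2 : ℤ) 2, ∀ b ∈ Finset.Icc (-2 : ℤ) 2,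
      ∀ c ∈ Finset.Icc (-2 : ℤ) 2, ∀ d ∈ Finset.Icc (-2 : ℤ) 2,
      2 * (a * a + b * b + c * c + d * d) + 2 * (b * b) - b * (a + b + c + d)
        - b * (a + b + c + d) = 2 →
      (∃ k, (pos k).coeff = ![a, b, c, d]) ∨ ∃ k, (pos k).coeff = -![a, b, c, d] := by
    decide +kernel
  have e : β.coeff = ![β.coeff 0, β.coeff 1, β.coeff 2, β.coeff 3] := by
    ext i; fin_cases i <;> rfl
  generalize β.coeff 0 = a at *
  generalize β.coeff 1 = b at *
  generalize β.coeff 2 = c at *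
  generalize β.coeff 3 = d at *
  -- twice the form is a sum of squares, which bounds the coefficients
  have hsq : (2 * a - b) ^ 2 + (2 * c - b) ^ 2 + (2 * d - b) ^ 2 + b ^ 2 = 4 := by linarith
  have bd : ∀ t : ℤ, t ^ 2 ≤ 4 → -2 ≤ t ∧ t ≤ 2 := fun t ht =>
    ⟨by nlinarith, by nlinarith⟩
  have hb := bd b (by
    nlinarith [sq_nonneg (2 * a - b), sq_nonneg (2 * c - b), sq_nonneg (2 * d - b)])
  have ha := bd (2 * a - b) (by
    nlinarith [sq_nonneg b, sq_nonneg (2 * c - b), sq_nonneg (2 * d - b)])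
  have hc := bd (2 * c - b) (by
    nlinarith [sq_nonneg b, sq_nonneg (2 * a - b), sq_nonneg (2 * d - b)])
  have hd := bd (2 * d - b) (by
    nlinarith [sq_nonneg b, sq_nonneg (2 * c - b), sq_nonneg (2 * a - b)])
  have := key a (by simp; omega) b (by simp; omega) c (by simp; omega) d (by simp; omega) h
  rw [← e] at this
  exact this.imp (fun ⟨k, hk⟩ => ⟨k, coeff_injective hk⟩) fun ⟨k, hk⟩ => ⟨k, coeff_injective hk⟩

theorem opp_opp (β : RootD4) : β.opp.opp = β := coeff_injective (neg_neg _)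

instance : Fintype RootD4 where
  elems := Finset.univ.image pos ∪ Finset.univ.image fun k => (pos k).opp
  complete β := by
    simp only [Finset.mem_union, Finset.mem_image, Finset.mem_univ, true_and]
    exact (exists_pos_eq_or β).imp id fun ⟨k, hk⟩ => ⟨k, by rw [hk, opp_opp]⟩

theorem add_ne_of_pairing_eq_zero {β γ : RootD4} (h : β.pairing γ = 0) :
    β.coeff + γ.coeff ≠ 0 ∧ ∀ δ : RootD4, β.coeff + γ.coeff ≠ δ.coeff := by
  revert β γ; decide +kernel

theorem pairing_of_add {β γ δ : RootD4} (h : β.coeff + γ.coeff = δ.coeff) :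
    β.pairing γ = -1 := by
  revert β γ δ; decide +kernel

/-! ### Coboundaries of signs -/

/-- A family of signs `d β γ`, of interest when `β + γ` is a root, that satisfies the relations
holding for the ratio of two systems of structure constants: symmetry, the cocycle relation coming
from the Jacobi identity for `β, γ, δ` with `[x_β, x_δ] = 0`, cyclic invariance for roots of sum
zero, and a change of sign under `(β, γ) ↦ (-β, -γ)`. The value of `d β γ` is arbitrary where
`β + γ` is not a root. -/
structure IsCocycle (d : RootD4 → RootD4 → ℤˣ) : Prop where
  symm : ∀ β γ δ : RootD4, β.coeff + γ.coeff = δ.coeff → d β γ = d γ β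
  assoc : ∀ β γ δ μ ν τ : RootD4, β.coeff + γ.coeff = μ.coeff → γ.coeff + δ.coeff = ν.coeff →
    μ.coeff + δ.coeff = τ.coeff → β.pairing δ = 0 → d β γ * d μ δ = d γ δ * d β ν
  cyclic : ∀ β γ δ : RootD4, β.coeff + γ.coeff + δ.coeff = 0 → d β γ = d γ δ
  opp : ∀ β γ δ : RootD4, β.coeff + γ.coeff = δ.coeff → d β.opp γ.opp = -d β γ

theorem pos_eq_simple_or (b : Fin 12) : (∃ i, pos b = simple i) ∨
    ∃ i b', (simple i).coeff + (pos b').coeff = (pos b).coeff ∧ b' < b := by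
  revert b; decide +kernel

/-- If `a + b` is a root and `b = αᵢ + b'`, then `a + b = (a + αᵢ) + b'` or
`a + b = (a + b') + αᵢ` through positive roots, in such a way that a cocycle relation applies. -/
theorem pos_add_assoc (a b c : Fin 12) (h : (pos a).coeff + (pos b).coeff = (pos c).coeff)
    (i : Fin 4) (b' : Fin 12) (h' : (simple i).coeff + (pos b').coeff = (pos b).coeff) :
    (∃ m, (pos a).coeff + (simple i).coeff = (pos m).coeff ∧
      (pos m).coeff + (pos b').coeff = (pos c).coeff ∧ (pos a).pairing (pos b') = 0) ∨
    ∃ m, (pos a).coeff + (pos b').coeff = (pos m).coeff ∧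
      (pos m).coeff + (simple i).coeff = (pos c).coeff ∧ (pos a).pairing (simple i) = 0 := by
  revert a b c; revert i b'; decide +kernel

/-- The covering relations of the poset of positive roots. -/
theorem simple_add_pos (i : Fin 4) (k l : Fin 12)
    (h : (simple i).coeff + (pos k).coeff = (pos l).coeff) :
    (i, k, l) ∈ ([(0, 1, 4), (1, 0, 4), (2, 1, 5), (1, 2, 5), (3, 1, 6), (1, 3, 6), (2, 4, 7),
      (0, 5, 7), (3, 4, 8), (0, 6, 8), (3, 5, 9), (2, 6, 9), (3, 7, 10), (2, 8, 10), (0, 9, 10),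
      (1, 10, 11)] : List (Fin 4 × Fin 12 × Fin 12)) := by
  revert i k l; decide +kernel

namespace IsCocycle

variable {d : RootD4 → RootD4 → ℤˣ}

/-- A cocycle is a coboundary on the pairs formed of a simple and a positive root. -/
theorem exists_pos_simple (hd : IsCocycle d) : ∃ p : Fin 12 → ℤˣ,
    (∀ k i, pos k = simple i → p k = 1) ∧
    ∀ i k l, (simple i).coeff + (pos k).coeff = (pos l).coeff →
      p l = d (simple i) (pos k) * p k := by
  -- the value at a root is fixed by one way of reaching it from a smaller root; the cocycle
  -- relations show that the other ways give the same value
  refine ⟨![1, 1, 1, 1, d (pos 0) (pos 1), d (pos 2) (pos 1), d (pos 3) (pos 1),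
    d (pos 2) (pos 4) * d (pos 0) (pos 1), d (pos 3) (pos 4) * d (pos 0) (pos 1),
    d (pos 3) (pos 5) * d (pos 2) (pos 1),
    d (pos 3) (pos 7) * (d (pos 2) (pos 4) * d (pos 0) (pos 1)),
    d (pos 1) (pos 10) * (d (pos 3) (pos 7) * (d (pos 2) (pos 4) * d (pos 0) (pos 1)))],
    ?_, ?_⟩
  · intro k i h
    have : k ∈ ([0, 1, 2, 3] : List (Fin 12)) := by revert k i; decide +kernel
    simp only [List.mem_cons, List.not_mem_nil, or_false] at this
    rcases this with rfl | rfl | rfl | rfl <;> rfl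
  · intro i k l h
    have h0 : simple 0 = pos 0 := rfl
    have h1 : simple 1 = pos 1 := rfl
    have h2 : simple 2 = pos 2 := rfl
    have h3 : simple 3 = pos 3 := rfl
    have key1 := hd.assoc (pos 0) (pos 1) (pos 2) (pos 4) (pos 5) (pos 7)
      (by decide) (by decide) (by decide) (by decide)
    have key2 := hd.assoc (pos 0) (pos 1) (pos 3) (pos 4) (pos 6) (pos 8)
      (by decide) (by decide) (by decide) (by decide)
    have key3 := hd.assoc (pos 2) (pos 1) (pos 3) (pos 5) (pos 6) (pos 9)
      (by decide) (by decide) (by decide) (by decide)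
    have key4 := hd.assoc (pos 2) (pos 4) (pos 3) (pos 7) (pos 8) (pos 10)
      (by decide) (by decide) (by decide) (by decide)
    have key5 := hd.assoc (pos 0) (pos 5) (pos 3) (pos 7) (pos 9) (pos 10)
      (by decide) (by decide) (by decide) (by decide)
    rw [hd.symm (pos 4) (pos 2) (pos 7) (by decide), hd.symm (pos 1) (pos 2) (pos 5) (by decide)]
      at key1
    rw [hd.symm (pos 4) (pos 3) (pos 8) (by decide), hd.symm (pos 1) (pos 3) (pos 6) (by decide)]
      at key2
    rw [hd.symm (pos 5) (pos 3) (pos 9) (by decide), hd.symm (pos 1) (pos 3) (pos 6) (by decide)]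
      at key3
    rw [hd.symm (pos 7) (pos 3) (pos 10) (by decide), hd.symm (pos 4) (pos 3) (pos 8) (by decide)]
      at key4
    rw [hd.symm (pos 7) (pos 3) (pos 10) (by decide), hd.symm (pos 5) (pos 3) (pos 9) (by decide)]
      at key5
    replace key1 := congrArg Units.val key1
    replace key2 := congrArg Units.val key2
    replace key3 := congrArg Units.val key3
    replace key4 := congrArg Units.val key4
    replace key5 := congrArg Units.val key5
    push_cast at key1 key2 key3 key4 key5
    have hl := simple_add_pos i k l h
    simp only [List.mem_cons, List.not_mem_nil, or_false, Prod.mk.injEq] at hl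
    rcases hl with ⟨rfl, rfl, rfl⟩ | ⟨rfl, rfl, rfl⟩ | ⟨rfl, rfl, rfl⟩ | ⟨rfl, rfl, rfl⟩ |
      ⟨rfl, rfl, rfl⟩ | ⟨rfl, rfl, rfl⟩ | ⟨rfl, rfl, rfl⟩ | ⟨rfl, rfl, rfl⟩ | ⟨rfl, rfl, rfl⟩ |
      ⟨rfl, rfl, rfl⟩ | ⟨rfl, rfl, rfl⟩ | ⟨rfl, rfl, rfl⟩ | ⟨rfl, rfl, rfl⟩ | ⟨rfl, rfl, rfl⟩ |
      ⟨rfl, rfl, rfl⟩ | ⟨rfl, rfl, rfl⟩ <;>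
    simp only [h0, h1, h2, h3] at h ⊢ <;>
    simp <;>
    first
    | exact hd.symm _ _ _ (by rw [add_comm, h])
    | (apply Units.ext; push_cast; linear_combination key1)
    | (apply Units.ext; push_cast; linear_combination key2)
    | (apply Units.ext; push_cast; linear_combination key3)
    | (apply Units.ext; push_cast; linear_combination (d (pos 0) (pos 1) : ℤ) * key4)
    | (apply Units.ext; push_cast
       linear_combination (d (pos 3) (pos 7) : ℤ) * key1 + (d (pos 2) (pos 1) : ℤ) * key5)

/-- A cocycle is a coboundary on the positive roots, by induction on the second root. -/
theorem exists_pos (hd : IsCocycle d) : ∃ p : Fin 12 → ℤˣ,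
    (∀ k i, pos k = simple i → p k = 1) ∧
    ∀ a b c, (pos a).coeff + (pos b).coeff = (pos c).coeff →
      p c = d (pos a) (pos b) * (p a * p b) := by
  obtain ⟨p, hp, hp'⟩ := hd.exists_pos_simple
  refine ⟨p, hp, fun a b => ?_⟩
  induction b using WellFoundedLT.induction generalizing a with
  | ind b ih =>
    intro c h
    rcases pos_eq_simple_or b with ⟨i, hi⟩ | ⟨i, b', e, hb⟩
    · rw [hp b i hi, mul_one, hd.symm _ _ _ h, hi]
      exact hp' i a c (by rw [← hi, add_comm, h])
    rcases pos_add_assoc a b c h i b' e with ⟨m, e1, e2, e3⟩ | ⟨m, e1, e2, e3⟩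
    · have key := hd.assoc _ _ _ _ _ _ e1 e e2 e3
      rw [hd.symm _ _ _ e1] at key
      rw [ih b' hb m c e2, hp' i a m (by rw [add_comm, e1]), hp' i b' b e]
      have key' := congrArg Units.val key
      push_cast at key'
      ext
      push_cast
      linear_combination (p a * p b' : ℤ) * key'
    · have key := hd.assoc _ _ _ _ _ _ e1 (by rw [add_comm, e]) e2 e3
      rw [hd.symm (pos m) _ _ e2, hd.symm (pos b') _ (pos b) (by rw [add_comm, e])] at key
      rw [hp' i m c (by rw [add_comm, e2]), ih b' hb a m e1, hp' i b' b e]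
      have key' := congrArg Units.val key
      push_cast at key'
      ext
      push_cast
      linear_combination (p a * p b' : ℤ) * key'

theorem pos_add (a b : Fin 12) (γ : RootD4) (h : (pos a).coeff + (pos b).coeff = γ.coeff) :
    ∃ c, pos c = γ := by
  revert a b γ; decide +kernel

/-- No root is both positive and negative. -/
theorem pos_or_opp (β : RootD4) :
    ((∃ k, pos k = β) ∧ ¬∃ k, pos k = β.opp) ∨ (¬(∃ k, pos k = β) ∧ ∃ k, pos k = β.opp) := by
  revert β; decide +kernel

theorem pos_injective : Function.Injective pos := by decide +kernel

/-- A cocycle of signs is a coboundary `s β * s γ * s (β + γ)`, where `s` is odd and trivial on the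
simple roots. -/
theorem exists_eq_coboundary (hd : IsCocycle d) : ∃ s : RootD4 → ℤˣ,
    (∀ i, s (simple i) = 1) ∧ (∀ β, s β.opp = -s β) ∧
    ∀ β γ δ : RootD4, β.coeff + γ.coeff = δ.coeff → d β γ = s β * s γ * s δ := by
  obtain ⟨p, hp, hadd⟩ := hd.exists_pos
  -- the signs on the positive roots, extended to an odd function
  let s : RootD4 → ℤˣ := fun β =>
    if h : ∃ k, pos k = β then p h.choose else if h : ∃ k, pos k = β.opp then -p h.choose else 1
  have hs : ∀ k, s (pos k) = p k := fun k => by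
    have h : ∃ j, pos j = pos k := ⟨k, rfl⟩
    simp only [s, dif_pos h, pos_injective h.choose_spec]
  have hs' : ∀ k, s (pos k).opp = -p k := fun k => by
    have h : ∃ j, pos j = (pos k).opp.opp := ⟨k, (opp_opp _).symm⟩
    have h' : ¬∃ j, pos j = (pos k).opp := by
      rcases pos_or_opp (pos k) with h1 | h1
      · exact h1.2
      · exact absurd ⟨k, rfl⟩ h1.1
    have e : h.choose = k := pos_injective (h.choose_spec.trans (opp_opp _))
    simp only [s, dif_neg h', dif_pos h, e]
  have hopp : ∀ β, s β.opp = -s β := fun β => by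
    rcases exists_pos_eq_or β with ⟨k, rfl⟩ | ⟨k, hk⟩
    · rw [hs, hs']
    · rw [← hk, hs, ← opp_opp β, ← hk, hs', neg_neg]
  -- in the symmetric form for `β + γ + δ = 0`, the claim is invariant under rotation and negation
  have main : ∀ β γ δ : RootD4, β.coeff + γ.coeff + δ.coeff = 0 →
      d β γ = -(s β * s γ * s δ) := by
    have pp : ∀ a b δ, (pos a).coeff + (pos b).coeff + δ.coeff = 0 →
        d (pos a) (pos b) = -(s (pos a) * s (pos b) * s δ) := fun a b δ h => by
      have h1 : (pos a).coeff + (pos b).coeff = δ.opp.coeff := eq_neg_of_add_eq_zero_left h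
      obtain ⟨c, hc⟩ := pos_add _ _ _ h1
      have h2 := hadd a b c (by rw [hc, h1])
      rw [← opp_opp δ, ← hc, hs', hs, hs, h2]
      generalize d (pos a) (pos b) = x
      generalize p a * p b = y
      revert x y
      decide
    have nn : ∀ a b δ, (pos a).opp.coeff + (pos b).opp.coeff + δ.coeff = 0 →
        d (pos a).opp (pos b).opp = -(s (pos a).opp * s (pos b).opp * s δ) := fun a b δ h => by
      have h1 : (pos a).coeff + (pos b).coeff + δ.opp.coeff = 0 := by
        have e : ∀ β : RootD4, β.opp.coeff = -β.coeff := fun _ => rfl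
        rw [e, e] at h
        rw [e, ← neg_eq_zero, ← h]
        abel
      rw [hd.opp _ _ δ (eq_neg_of_add_eq_zero_left h1 |>.trans (neg_neg _)), pp a b _ h1, hopp,
        hopp, hopp]
      simp
    have rot : ∀ β γ δ, β.coeff + γ.coeff + δ.coeff = 0 → d γ δ = -(s γ * s δ * s β) →
        d β γ = -(s β * s γ * s δ) := fun β γ δ h e => by
      rw [hd.cyclic β γ δ h, e, mul_comm (s γ * s δ), mul_assoc]
    intro β γ δ h
    have h1 : γ.coeff + δ.coeff + β.coeff = 0 := by rw [← h]; abel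
    have h2 : δ.coeff + β.coeff + γ.coeff = 0 := by rw [← h]; abel
    have hneg : ∀ β, (∃ k, pos k = β) ∨ ∃ k, (pos k).opp = β := fun β =>
      (exists_pos_eq_or β).imp id fun ⟨k, hk⟩ => ⟨k, by rw [hk, opp_opp]⟩
    -- two of the three roots have the same sign
    rcases hneg β with ⟨a, rfl⟩ | ⟨a, rfl⟩ <;> rcases hneg γ with ⟨b, rfl⟩ | ⟨b, rfl⟩ <;>
      rcases hneg δ with ⟨c, rfl⟩ | ⟨c, rfl⟩ <;>
    first
    | exact pp _ _ _ h
    | exact nn _ _ _ h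
    | exact rot _ _ _ h (pp _ _ _ h1)
    | exact rot _ _ _ h (nn _ _ _ h1)
    | exact rot _ _ _ h (rot _ _ _ h1 (pp _ _ _ h2))
    | exact rot _ _ _ h (rot _ _ _ h1 (nn _ _ _ h2))
  refine ⟨s, fun i => ?_, hopp, fun β γ δ h => ?_⟩
  · have : ∃ k, pos k = simple i := by revert i; decide +kernel
    obtain ⟨k, hk⟩ := this
    rw [← hk, hs, hp k i hk]
  · rw [main β γ δ.opp (by rw [h]; exact add_neg_cancel _), hopp]
    simp

end IsCocycle

end RootD4

/-! ### Normal form of the structure constants -/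

namespace RootD4

/-- A bilinear form on the root lattice, invariant under the diagram automorphisms, such that
`form β γ + form γ β` is congruent to `(β, γ)` and `form β β` to `(β, β) / 2` modulo `2`: it is
`∑ aᵢ bᵢ + a₁ (b₀ + b₂ + b₃)`. -/
def form (a b : Fin 4 → ℤ) : ℤ := ∑ i, a i * b i + a 1 * ∑ i, b i - a 1 * b 1

/-- The bimultiplicative sign `(-1) ^ form β γ`. -/
def eps (a b : Fin 4 → ℤ) : ℤˣ := (form a b).negOnePow

theorem eps_add_left (a b c : Fin 4 → ℤ) : eps (a + b) c = eps a c * eps b c := by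
  rw [eps, eps, eps, ← Int.negOnePow_add]
  congr 1
  simp only [form, Pi.add_apply, add_mul, Finset.sum_add_distrib]
  ring

theorem eps_add_right (a b c : Fin 4 → ℤ) : eps a (b + c) = eps a b * eps a c := by
  rw [eps, eps, eps, ← Int.negOnePow_add]
  congr 1
  simp only [form, Pi.add_apply, mul_add, Finset.sum_add_distrib]
  ring

theorem eps_neg_left (a b : Fin 4 → ℤ) : eps (-a) b = eps a b := by
  rw [eps, eps, ← Int.negOnePow_neg]
  congr 1
  simp only [form, Pi.neg_apply, neg_mul, Finset.sum_neg_distrib]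
  ring

theorem eps_neg_right (a b : Fin 4 → ℤ) : eps a (-b) = eps a b := by
  rw [eps, eps, ← Int.negOnePow_neg]
  congr 1
  simp only [form, Pi.neg_apply, mul_neg, Finset.sum_neg_distrib]
  ring

theorem eps_swap (β γ : RootD4) :
    eps β.coeff γ.coeff = (β.pairing γ).negOnePow * eps γ.coeff β.coeff := by
  rw [eps, eps, ← Int.negOnePow_add, Int.negOnePow_eq_iff, pairing_eq]
  have e : ∑ i, γ.coeff i * β.coeff i = ∑ i, β.coeff i * γ.coeff i :=
    Finset.sum_congr rfl fun i _ => mul_comm _ _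
  rw [form, form, e]
  exact ⟨-∑ i, β.coeff i * γ.coeff i + β.coeff 1 * ∑ i, γ.coeff i - β.coeff 1 * γ.coeff 1,
    by ring⟩

theorem eps_self (β : RootD4) : eps β.coeff β.coeff = -1 := by
  have h := β.pairing_self
  rw [pairing_eq] at h
  rw [eps, ← Int.negOnePow_one, Int.negOnePow_eq_iff, form]
  exact ⟨β.coeff 1 * ∑ i, β.coeff i - β.coeff 1 * β.coeff 1, by linarith⟩

theorem eps_comm_of_add {β γ δ : RootD4} (h : β.coeff + γ.coeff = δ.coeff) :
    eps β.coeff γ.coeff = -eps γ.coeff β.coeff := by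
  rw [eps_swap, pairing_of_add h]; simp

theorem coeff_opp (β : RootD4) : β.opp.coeff = -β.coeff := rfl

theorem coeff_simple (i : Fin 4) : (simple i).coeff = Pi.single i 1 := rfl

theorem pairing_opp_right (β γ : RootD4) : β.pairing γ.opp = -β.pairing γ := by
  simp [pairing, coeff_opp, Matrix.mulVec_neg]

end RootD4

namespace ChevalleyBasisD4

open RootD4

variable {F L : Type*} [Field F] [LieRing L] [LieAlgebra F L] (C : ChevalleyBasisD4 F L)

theorem lie_x_add {β γ δ : RootD4} (h : β.coeff + γ.coeff = δ.coeff) :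
    ⁅C.x β, C.x γ⁆ = (C.c β γ : F) • C.x δ := C.lie_x_x β γ δ h

theorem x_ne_zero (β : RootD4) : C.x β ≠ 0 := C.basis.ne_zero _

theorem lie_x_of_pairing_eq_zero {β γ : RootD4} (h : β.pairing γ = 0) : ⁅C.x β, C.x γ⁆ = 0 :=
  C.lie_x_x_zero β γ (add_ne_of_pairing_eq_zero h).1 (add_ne_of_pairing_eq_zero h).2

theorem int_cast_inj_of_units (h2 : (2 : F) ≠ 0) {a b : ℤ} (ha : a = 1 ∨ a = -1)
    (hb : b = 1 ∨ b = -1) (h : (a : F) = b) : a = b := by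
  have : (1 : F) ≠ -1 := fun h => h2 (by linear_combination h)
  rcases ha with rfl | rfl <;> rcases hb with rfl | rfl <;> simp_all [eq_comm]

theorem mul_unit {a b : ℤ} (ha : a = 1 ∨ a = -1) (hb : b = 1 ∨ b = -1) :
    a * b = 1 ∨ a * b = -1 := by
  rcases ha with rfl | rfl <;> rcases hb with rfl | rfl <;> simp

/-- The structure constants are skew-symmetric, since the bracket is. -/
theorem c_symm (h2 : (2 : F) ≠ 0) {β γ δ : RootD4} (h : β.coeff + γ.coeff = δ.coeff) :
    C.c β γ = -C.c γ β := by
  have h' : γ.coeff + β.coeff = δ.coeff := by rw [add_comm, h]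
  have e := lie_skew (C.x β) (C.x γ)
  rw [C.lie_x_add h, C.lie_x_add h', ← neg_smul] at e
  have e' := smul_left_injective F (C.x_ne_zero δ) e
  refine int_cast_inj_of_units h2 (C.c_unit β γ δ h) ?_ (by push_cast; exact e'.symm)
  have := C.c_unit γ β δ h'
  omega

/-- The Jacobi identity for three root vectors, two of which commute. -/
theorem c_assoc (h2 : (2 : F) ≠ 0) {β γ δ μ ν τ : RootD4} (h₁ : β.coeff + γ.coeff = μ.coeff)
    (h₃ : γ.coeff + δ.coeff = ν.coeff) (h₄ : μ.coeff + δ.coeff = τ.coeff)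
    (h : β.pairing δ = 0) : C.c β γ * C.c μ δ = C.c γ δ * C.c β ν := by
  have h₅ : β.coeff + ν.coeff = τ.coeff := by rw [← h₃, ← add_assoc, h₁, h₄]
  have e := leibniz_lie (C.x β) (C.x γ) (C.x δ)
  rw [C.lie_x_of_pairing_eq_zero h, lie_zero, add_zero, C.lie_x_add h₁, C.lie_x_add h₃, lie_smul,
    smul_lie, C.lie_x_add h₄, C.lie_x_add h₅, smul_smul, smul_smul] at e
  have e' := smul_left_injective F (C.x_ne_zero τ) e
  exact int_cast_inj_of_units h2 (mul_unit (C.c_unit _ _ _ h₁) (C.c_unit _ _ _ h₄))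
    (mul_unit (C.c_unit _ _ _ h₃) (C.c_unit _ _ _ h₅)) (by push_cast; exact e'.symm)

theorem lie_coroot_x (β γ : RootD4) :
    ⁅∑ i, (β.coeff i : F) • C.basis (Sum.inl i), C.x γ⁆ = (β.pairing γ : F) • C.x γ := by
  have e : β.pairing γ = ∑ i, β.coeff i * γ.pairing (simple i) := by
    simp only [pairing_eq, Fin.sum_univ_four, coeff_simple]
    simp
    ring
  simp only [sum_lie, smul_lie, x, C.lie_h_x, smul_smul, e]
  rw [← Finset.sum_smul]
  push_cast
  rfl

theorem lie_x_opp' (β : RootD4) :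
    ⁅C.x β, C.x β.opp⁆ = ∑ i, (β.coeff i : F) • C.basis (Sum.inl i) := C.lie_x_opp β

/-- The Jacobi identity for `x_β`, `x_γ`, `x_{-γ}`. -/
theorem c_mul_c_opp (h2 : (2 : F) ≠ 0) {β γ δ : RootD4} (h : β.coeff + γ.coeff = δ.coeff) :
    C.c β γ * C.c δ γ.opp = 1 := by
  have hδ : δ.coeff + γ.opp.coeff = β.coeff := by rw [← h, coeff_opp]; abel
  have hp : β.pairing γ = -1 := pairing_of_add h
  have h0 : β.coeff + γ.opp.coeff ≠ 0 := fun e => by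
    have : β = γ := coeff_injective (by rwa [coeff_opp, add_neg_eq_zero] at e)
    rw [this, pairing_self] at hp
    norm_num at hp
  have h1 : ∀ ε : RootD4, β.coeff + γ.opp.coeff ≠ ε.coeff := fun ε e => by
    have := pairing_of_add e
    rw [pairing_opp_right, hp] at this
    norm_num at this
  have hs : γ.pairing β = -1 := pairing_of_add (by rw [add_comm, h])
  have e := leibniz_lie (C.x β) (C.x γ) (C.x γ.opp)
  rw [C.lie_x_opp', ← lie_skew, lie_coroot_x, hs, C.lie_x_add h, smul_lie, C.lie_x_add hδ,
    show ⁅C.x β, C.x γ.opp⁆ = 0 from C.lie_x_x_zero _ _ h0 h1, lie_zero, add_zero, smul_smul,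
    ← neg_smul] at e
  have e' := smul_left_injective F (C.x_ne_zero β) e
  refine int_cast_inj_of_units h2 (mul_unit (C.c_unit _ _ _ h) (C.c_unit _ _ _ hδ)) (Or.inl rfl)
    (by push_cast; rw [← e']; push_cast; ring)

/-- Up to the signs of the root vectors, the structure constants are the bimultiplicative signs
`eps`. The signs are trivial on the simple roots, and `s (-β) = -s β` since `[x_β, x_{-β}]` is the
coroot of `β`, whereas `eps β (-β) = -1`. -/
theorem exists_sign (h2 : (2 : F) ≠ 0) : ∃ s : RootD4 → ℤˣ,
    (∀ i, s (simple i) = 1) ∧ (∀ β, s β.opp = -s β) ∧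
    ∀ β γ δ : RootD4, β.coeff + γ.coeff = δ.coeff →
      C.c β γ = (eps β.coeff γ.coeff * (s β * s γ * s δ) : ℤˣ) := by
  -- the structure constants as units
  let u : RootD4 → RootD4 → ℤˣ := fun β γ => if C.c β γ = 1 then 1 else -1
  have hu : ∀ {β γ δ : RootD4}, β.coeff + γ.coeff = δ.coeff → (u β γ : ℤ) = C.c β γ := by
    intro β γ δ h
    rcases C.c_unit β γ δ h with e | e <;> simp [u, e]
  -- both `u` and `eps` are skew-symmetric and satisfy the cocycle relation, so that the ratio is
  -- a symmetric cocycle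
  let d : RootD4 → RootD4 → ℤˣ := fun β γ => u β γ * eps β.coeff γ.coeff
  have hsq : ∀ v : ℤˣ, v * v = 1 := Int.units_mul_self
  have hd : IsCocycle d := by
    refine ⟨fun β γ δ h => ?_, fun β γ δ μ ν τ h₁ h₃ h₄ h => ?_, fun β γ δ h => ?_,
      fun β γ δ h => ?_⟩
    · have h' : γ.coeff + β.coeff = δ.coeff := by rw [add_comm, h]
      have : u β γ = -u γ β := Units.ext (by
        rw [hu h, Units.val_neg, hu h', C.c_symm h2 h])
      simp only [d]
      rw [this, eps_comm_of_add h, neg_mul_neg]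
    · have h₅ : β.coeff + ν.coeff = τ.coeff := by rw [← h₃, ← add_assoc, h₁, h₄]
      have : u β γ * u μ δ = u γ δ * u β ν := Units.ext (by
        push_cast
        rw [hu h₁, hu h₃, hu h₄, hu h₅, C.c_assoc h2 h₁ h₃ h₄ h])
      simp only [d]
      have he : eps β.coeff γ.coeff * eps μ.coeff δ.coeff =
          eps γ.coeff δ.coeff * eps β.coeff ν.coeff := by
        rw [← h₁, ← h₃, eps_add_left, eps_add_right]
        ac_rfl
      rw [mul_mul_mul_comm, this, he, mul_mul_mul_comm]
    · have hδ : β.coeff + γ.coeff = δ.opp.coeff := eq_neg_of_add_eq_zero_left h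
      have h₁ : δ.opp.coeff + γ.opp.coeff = β.coeff := by rw [← hδ, coeff_opp]; abel
      have h₃ : δ.coeff + γ.coeff = β.opp.coeff := by
        rw [coeff_opp]; exact eq_neg_of_add_eq_zero_left (by rw [← h]; abel)
      have h₄ : γ.coeff + δ.coeff = β.opp.coeff := by rw [add_comm, h₃]
      have e1 := C.c_mul_c_opp h2 hδ
      have e2 := C.c_opp _ _ _ h₁
      rw [opp_opp, opp_opp] at e2
      have e3 := C.c_symm h2 h₃
      have hu' : u β γ = u γ δ := by
        apply Units.ext
        rw [hu hδ, hu h₄]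
        rw [e2, e3, neg_neg] at e1
        rcases C.c_unit _ _ _ hδ with e | e <;> rw [e] at e1 ⊢ <;> omega
      simp only [d]
      have hc : δ.coeff = -(β.coeff + γ.coeff) := by rw [hδ, coeff_opp, neg_neg]
      rw [hu', hc, eps_neg_right, eps_add_right, eps_self, eps_comm_of_add hδ]
      simp
    · have h' : β.opp.coeff + γ.opp.coeff = δ.opp.coeff := by
        rw [coeff_opp, coeff_opp, coeff_opp, ← h]; abel
      have : u β.opp γ.opp = -u β γ := Units.ext (by
        rw [hu h', Units.val_neg, hu h, C.c_opp β γ δ h, neg_neg])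
      simp only [d]
      rw [this, coeff_opp, coeff_opp, eps_neg_left, eps_neg_right, neg_mul]
  obtain ⟨s, h1, h3, h4⟩ := hd.exists_eq_coboundary
  refine ⟨s, h1, h3, fun β γ δ h => ?_⟩
  rw [← h4 β γ δ h, ← hu h]
  simp only [d]
  rw [mul_comm, mul_assoc, hsq, mul_one]

end ChevalleyBasisD4

/-! ### Tensors of format `2 × 2 × 2` and their invariants -/

section Permutation

variable {ι : Type*} {k : Type*} [CommRing k]

/-- The endomorphism of `⨂ k²` that permutes the tensor factors: the `i`-th factor is moved to the
`σ i`-th place. A tensor is the array of its coefficients, indexed by `ι → Fin 2`. -/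
def permMap (k : Type*) [CommRing k] (σ : Equiv.Perm ι) : Module.End k ((ι → Fin 2) → k) :=
  LinearMap.funLeft k k fun n => n ∘ σ

@[simp]
theorem permMap_apply (σ : Equiv.Perm ι) (v : (ι → Fin 2) → k) (n : ι → Fin 2) :
    permMap k σ v n = v (n ∘ σ) := rfl

theorem permMap_mul (σ τ : Equiv.Perm ι) : permMap k (σ * τ) = permMap k σ * permMap k τ := rfl

theorem permMap_one : permMap k (1 : Equiv.Perm ι) = 1 := rfl

theorem permMap_single [Fintype ι] (σ : Equiv.Perm ι) (n : ι → Fin 2) :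
    permMap k σ (Pi.single n 1) = Pi.single (n ∘ σ.symm) 1 := by
  ext m
  simp only [permMap_apply, Pi.single_apply]
  congr 1
  rw [eq_iff_iff, Equiv.eq_comp_symm]

end Permutation

section Kronecker

variable {ι k : Type*} [Fintype ι] [DecidableEq ι] [CommRing k]

/-- The endomorphism `⨂ A i` of the tensor power `⨂ k²`, written in coordinates: a tensor is the
array of its coefficients, indexed by `ι → Fin 2`. -/
def tensorMap (A : ι → Matrix (Fin 2) (Fin 2) k) : Module.End k ((ι → Fin 2) → k) :=
  Matrix.mulVecLin (Matrix.of fun n m => ∏ i, A i (n i) (m i))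

theorem tensorMap_apply (A : ι → Matrix (Fin 2) (Fin 2) k) (v : (ι → Fin 2) → k) (n : ι → Fin 2) :
    tensorMap A v n = ∑ m, (∏ i, A i (n i) (m i)) * v m := rfl

theorem tensorMap_single (A : ι → Matrix (Fin 2) (Fin 2) k) (m n : ι → Fin 2) :
    tensorMap A (Pi.single m 1) n = ∏ i, A i (n i) (m i) := by
  simp [tensorMap_apply, Pi.single_apply]

theorem tensorMap_mul (A B : ι → Matrix (Fin 2) (Fin 2) k) :
    tensorMap (A * B) = tensorMap A * tensorMap B := by
  rw [tensorMap, tensorMap, tensorMap, Module.End.mul_eq_comp, ← Matrix.mulVecLin_mul]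
  congr 1
  ext n m
  simp only [Matrix.of_apply, Matrix.mul_apply, Pi.mul_apply, Finset.prod_univ_sum,
    Fintype.piFinset_univ, Finset.prod_mul_distrib]

theorem tensorMap_one : tensorMap (1 : ι → Matrix (Fin 2) (Fin 2) k) = 1 := by
  have : (Matrix.of fun n m : ι → Fin 2 => ∏ i, (1 : ι → Matrix (Fin 2) (Fin 2) k) i (n i) (m i)) =
      1 := by
    ext n m
    simp only [Matrix.of_apply, Pi.one_apply, Matrix.one_apply, Finset.prod_ite_zero,
      Finset.prod_const_one, Finset.mem_univ, true_imp_iff, funext_iff]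
  rw [tensorMap, this, Matrix.mulVecLin_one]
  rfl

theorem tensorMap_smul (c : ι → k) (A : ι → Matrix (Fin 2) (Fin 2) k) :
    tensorMap (fun i => c i • A i) = (∏ i, c i) • tensorMap A := by
  ext v n
  simp only [LinearMap.comp_apply, LinearMap.smul_apply, LinearMap.single_apply, tensorMap_single,
    Matrix.smul_apply, Pi.smul_apply, smul_eq_mul, Finset.prod_mul_distrib]

/-- A matrix acting on the `i`-th factor. -/
theorem tensorMap_mulSingle (i : ι) (M : Matrix (Fin 2) (Fin 2) k) (v : (ι → Fin 2) → k)
    (n : ι → Fin 2) : tensorMap (Pi.mulSingle i M) v n =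
      ∑ b, M (n i) b * v (Function.update n i b) := by
  rw [tensorMap_apply, ← Finset.sum_subset (Finset.subset_univ
    (Finset.univ.image fun b => Function.update n i b)), Finset.sum_image]
  · refine Finset.sum_congr rfl fun b _ => ?_
    rw [Finset.prod_eq_single i]
    · simp
    · intro j _ hj
      simp [Pi.mulSingle_eq_of_ne hj, Function.update_of_ne hj]
    · simp
  · intro a _ b _ h
    simpa using congrFun h i
  · intro m _ hm
    have : ∃ j, j ≠ i ∧ n j ≠ m j := by
      by_contra! h
      refine hm (Finset.mem_image.2 ⟨m i, Finset.mem_univ _, ?_⟩)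
      ext j
      by_cases hj : j = i
      · subst hj; simp
      · simp [Function.update_of_ne hj, h j hj]
    obtain ⟨j, hj, hne⟩ := this
    rw [Finset.prod_eq_zero (Finset.mem_univ j), zero_mul]
    simp [Pi.mulSingle_eq_of_ne hj, hne]

theorem permMap_mul_tensorMap (σ : Equiv.Perm ι) (A : ι → Matrix (Fin 2) (Fin 2) k) :
    permMap k σ * tensorMap A = tensorMap (A ∘ σ.symm) * permMap k σ := by
  refine LinearMap.ext fun v => funext fun n => ?_
  simp only [Module.End.mul_apply, permMap_apply, tensorMap_apply]
  refine Fintype.sum_equiv (Equiv.arrowCongr σ (Equiv.refl _)) _ _ fun m => ?_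
  congr 1
  · refine Fintype.prod_equiv σ _ _ fun i => ?_
    simp
  · congr 1
    ext i
    simp

end Kronecker

namespace ChevalleyBasisD4

/-- The outer node `0`. -/
def o₀ : Outer := ⟨0, by decide⟩
/-- The outer node `2`. -/
def o₂ : Outer := ⟨2, by decide⟩
/-- The outer node `3`. -/
def o₃ : Outer := ⟨3, by decide⟩

theorem eq_outer (o : Outer) : o = o₀ ∨ o = o₂ ∨ o = o₃ := by revert o; decide

theorem prod_outer {M : Type*} [CommMonoid M] (f : Outer → M) :
    ∏ i, f i = f o₀ * f o₂ * f o₃ := by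
  rw [show (Finset.univ : Finset Outer) = {o₀, o₂, o₃} by decide,
    Finset.prod_insert (by decide), Finset.prod_insert (by decide), Finset.prod_singleton,
    mul_assoc]

theorem sum_outer {M : Type*} [AddCommMonoid M] (f : Outer → M) :
    ∑ i, f i = f o₀ + f o₂ + f o₃ := by
  rw [show (Finset.univ : Finset Outer) = {o₀, o₂, o₃} by decide,
    Finset.sum_insert (by decide), Finset.sum_insert (by decide), Finset.sum_singleton,
    add_assoc]

/-- The family with the given values at the three outer nodes. -/
def idx (a b c : Fin 2) : Outer → Fin 2 := fun i => ![a, 0, b, c] i.1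

section idx
variable (a b c x : Fin 2)
@[simp] theorem idx_o₀ : idx a b c o₀ = a := rfl
@[simp] theorem idx_o₂ : idx a b c o₂ = b := rfl
@[simp] theorem idx_o₃ : idx a b c o₃ = c := rfl
@[simp] theorem update_idx_o₀ : Function.update (idx a b c) o₀ x = idx x b c := by
  revert a b c x; decide
@[simp] theorem update_idx_o₂ : Function.update (idx a b c) o₂ x = idx a x c := by
  revert a b c x; decide
@[simp] theorem update_idx_o₃ : Function.update (idx a b c) o₃ x = idx a b x := by
  revert a b c x; decide
end idx

theorem exists_eq_idx (n : Outer → Fin 2) : ∃ a b c, n = idx a b c :=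
  ⟨n o₀, n o₂, n o₃, funext fun i => by rcases eq_outer i with rfl | rfl | rfl <;> rfl⟩

theorem sum_idx {M : Type*} [AddCommMonoid M] (f : (Outer → Fin 2) → M) :
    ∑ n, f n = ∑ a, ∑ b, ∑ c, f (idx a b c) := by
  simp only [← Fintype.sum_prod_type']
  refine (Fintype.sum_bijective (fun p : Fin 2 × Fin 2 × Fin 2 => idx p.1 p.2.1 p.2.2) ?_ _ _
    fun _ => rfl).symm
  decide

section Forms

variable {k : Type*} [CommRing k]

/-- The Cayley hyperdeterminant of a `2 × 2 × 2` array. -/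
def hyperdet (v : (Outer → Fin 2) → k) : k :=
  v (idx 0 0 0) ^ 2 * v (idx 1 1 1) ^ 2 + v (idx 0 0 1) ^ 2 * v (idx 1 1 0) ^ 2
    + v (idx 0 1 0) ^ 2 * v (idx 1 0 1) ^ 2 + v (idx 1 0 0) ^ 2 * v (idx 0 1 1) ^ 2
    - 2 * (v (idx 0 0 0) * v (idx 0 0 1) * v (idx 1 1 0) * v (idx 1 1 1)
      + v (idx 0 0 0) * v (idx 0 1 0) * v (idx 1 0 1) * v (idx 1 1 1)
      + v (idx 0 0 0) * v (idx 1 0 0) * v (idx 0 1 1) * v (idx 1 1 1)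
      + v (idx 0 0 1) * v (idx 0 1 0) * v (idx 1 0 1) * v (idx 1 1 0)
      + v (idx 0 0 1) * v (idx 1 0 0) * v (idx 0 1 1) * v (idx 1 1 0)
      + v (idx 0 1 0) * v (idx 1 0 0) * v (idx 0 1 1) * v (idx 1 0 1))
    + 4 * (v (idx 0 0 0) * v (idx 0 1 1) * v (idx 1 0 1) * v (idx 1 1 0)
      + v (idx 0 0 1) * v (idx 0 1 0) * v (idx 1 0 0) * v (idx 1 1 1))

/-- The tensor product of the three symplectic forms on the factors `k²`. -/
def symp (v w : (Outer → Fin 2) → k) : k :=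
  v (idx 0 0 0) * w (idx 1 1 1) - v (idx 0 0 1) * w (idx 1 1 0)
    - v (idx 0 1 0) * w (idx 1 0 1) + v (idx 0 1 1) * w (idx 1 0 0)
    - v (idx 1 0 0) * w (idx 0 1 1) + v (idx 1 0 1) * w (idx 0 1 0)
    + v (idx 1 1 0) * w (idx 0 0 1) - v (idx 1 1 1) * w (idx 0 0 0)

theorem hyperdet_tensorMap_mulSingle (o : Outer) (M : Matrix (Fin 2) (Fin 2) k)
    (v : (Outer → Fin 2) → k) :
    hyperdet (tensorMap (Pi.mulSingle o M) v) = M.det ^ 2 * hyperdet v := by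
  rcases eq_outer o with rfl | rfl | rfl <;>
  · simp only [hyperdet, tensorMap_mulSingle, Fin.sum_univ_two, idx_o₀, idx_o₂, idx_o₃,
      update_idx_o₀, update_idx_o₂, update_idx_o₃, Matrix.det_fin_two]
    ring

theorem symp_tensorMap_mulSingle (o : Outer) (M : Matrix (Fin 2) (Fin 2) k)
    (v w : (Outer → Fin 2) → k) :
    symp (tensorMap (Pi.mulSingle o M) v) (tensorMap (Pi.mulSingle o M) w) =
      M.det * symp v w := by
  rcases eq_outer o with rfl | rfl | rfl <;>
  · simp only [symp, tensorMap_mulSingle, Fin.sum_univ_two, idx_o₀, idx_o₂, idx_o₃, update_idx_o₀,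
      update_idx_o₂, update_idx_o₃, Matrix.det_fin_two]
    ring

theorem eq_mul_mulSingle {M : Type*} [Monoid M] (A : Outer → M) :
    A = Pi.mulSingle o₀ (A o₀) * (Pi.mulSingle o₂ (A o₂) * Pi.mulSingle o₃ (A o₃)) := by
  have h : o₀ ≠ o₂ ∧ o₀ ≠ o₃ ∧ o₂ ≠ o₃ := by decide
  ext i
  rcases eq_outer i with rfl | rfl | rfl <;>
    simp [Pi.mulSingle_eq_of_ne, h.1, h.1.symm, h.2.1, h.2.1.symm, h.2.2, h.2.2.symm]

theorem hyperdet_tensorMap (A : Outer → Matrix (Fin 2) (Fin 2) k) (v : (Outer → Fin 2) → k) :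
    hyperdet (tensorMap A v) = (∏ i, (A i).det) ^ 2 * hyperdet v := by
  conv_lhs => rw [eq_mul_mulSingle A]
  simp only [tensorMap_mul, Module.End.mul_apply, hyperdet_tensorMap_mulSingle, prod_outer]
  ring

theorem symp_tensorMap (A : Outer → Matrix (Fin 2) (Fin 2) k) (v w : (Outer → Fin 2) → k) :
    symp (tensorMap A v) (tensorMap A w) = (∏ i, (A i).det) * symp v w := by
  conv_lhs => rw [eq_mul_mulSingle A]
  simp only [tensorMap_mul, Module.End.mul_apply, symp_tensorMap_mulSingle, prod_outer]
  ring

theorem idx_comp (a b c : Fin 2) (σ : Equiv.Perm Outer) :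
    idx a b c ∘ σ = idx (idx a b c (σ o₀)) (idx a b c (σ o₂)) (idx a b c (σ o₃)) := by
  funext i; rcases eq_outer i with rfl | rfl | rfl <;> rfl

theorem perm_outer (σ : Equiv.Perm Outer) :
    (σ o₀ = o₀ ∧ σ o₂ = o₂ ∧ σ o₃ = o₃) ∨ (σ o₀ = o₀ ∧ σ o₂ = o₃ ∧ σ o₃ = o₂) ∨
    (σ o₀ = o₂ ∧ σ o₂ = o₀ ∧ σ o₃ = o₃) ∨ (σ o₀ = o₂ ∧ σ o₂ = o₃ ∧ σ o₃ = o₀) ∨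
    (σ o₀ = o₃ ∧ σ o₂ = o₀ ∧ σ o₃ = o₂) ∨ (σ o₀ = o₃ ∧ σ o₂ = o₂ ∧ σ o₃ = o₀) := by
  revert σ; decide

theorem hyperdet_permMap (σ : Equiv.Perm Outer) (v : (Outer → Fin 2) → k) :
    hyperdet (permMap k σ v) = hyperdet v := by
  simp only [hyperdet, permMap_apply, idx_comp]
  rcases perm_outer σ with ⟨h₀, h₂, h₃⟩ | ⟨h₀, h₂, h₃⟩ | ⟨h₀, h₂, h₃⟩ | ⟨h₀, h₂, h₃⟩ |
    ⟨h₀, h₂, h₃⟩ | ⟨h₀, h₂, h₃⟩ <;>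
  simp only [h₀, h₂, h₃, idx_o₀, idx_o₂, idx_o₃] <;> ring

theorem symp_permMap (σ : Equiv.Perm Outer) (v w : (Outer → Fin 2) → k) :
    symp (permMap k σ v) (permMap k σ w) = symp v w := by
  simp only [symp, permMap_apply, idx_comp]
  rcases perm_outer σ with ⟨h₀, h₂, h₃⟩ | ⟨h₀, h₂, h₃⟩ | ⟨h₀, h₂, h₃⟩ | ⟨h₀, h₂, h₃⟩ |
    ⟨h₀, h₂, h₃⟩ | ⟨h₀, h₂, h₃⟩ <;>
  simp only [h₀, h₂, h₃, idx_o₀, idx_o₂, idx_o₃] <;> ring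

end Forms

end ChevalleyBasisD4

/-! ### Pure tensors -/

namespace ChevalleyBasisD4

/-- A tensor is pure if the `2 × 2` minors of all its flattenings vanish. -/
def IsPure {ι k : Type*} [DecidableEq ι] [Mul k] (v : (ι → Fin 2) → k) : Prop :=
  ∀ i n m, v n * v m = v (Function.update n i (m i)) * v (Function.update m i (n i))

/-- The array with the given entries. -/
def arr {k : Type*} (x : Fin 2 → Fin 2 → Fin 2 → k) : (Outer → Fin 2) → k :=
  fun n => x (n o₀) (n o₂) (n o₃)

theorem arr_idx {k : Type*} (x : Fin 2 → Fin 2 → Fin 2 → k) (a b c : Fin 2) :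
    arr x (idx a b c) = x a b c := rfl

section
variable {k : Type*} [Field k]

/-- The equations of purity: the minors of the six faces of the cube, and the equality of the
products along the four diagonals. -/
theorem isPure_iff_minors (v : (Outer → Fin 2) → k) : IsPure v ↔
    (v (idx 0 0 0) * v (idx 0 1 1) = v (idx 0 0 1) * v (idx 0 1 0) ∧
     v (idx 1 0 0) * v (idx 1 1 1) = v (idx 1 0 1) * v (idx 1 1 0) ∧
     v (idx 0 0 0) * v (idx 1 0 1) = v (idx 0 0 1) * v (idx 1 0 0) ∧
     v (idx 0 1 0) * v (idx 1 1 1) = v (idx 0 1 1) * v (idx 1 1 0) ∧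
     v (idx 0 0 0) * v (idx 1 1 0) = v (idx 0 1 0) * v (idx 1 0 0) ∧
     v (idx 0 0 1) * v (idx 1 1 1) = v (idx 0 1 1) * v (idx 1 0 1)) ∧
    v (idx 0 0 0) * v (idx 1 1 1) = v (idx 0 0 1) * v (idx 1 1 0) ∧
    v (idx 0 0 0) * v (idx 1 1 1) = v (idx 0 1 0) * v (idx 1 0 1) ∧
    v (idx 0 0 0) * v (idx 1 1 1) = v (idx 1 0 0) * v (idx 0 1 1) := by
  constructor
  · intro h
    have h₀ := fun b c b' c' => h o₀ (idx 0 b c) (idx 1 b' c')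
    have h₂ := fun b c b' c' => h o₂ (idx b 0 c) (idx b' 1 c')
    have h₃ := fun b c b' c' => h o₃ (idx b c 0) (idx b' c' 1)
    simp only [idx_o₀, idx_o₂, idx_o₃, update_idx_o₀, update_idx_o₂, update_idx_o₃] at h₀ h₂ h₃
    refine ⟨⟨?_, ?_, ?_, ?_, ?_, ?_⟩, ?_, ?_, ?_⟩
    · linear_combination h₂ 0 0 0 1
    · linear_combination h₂ 1 0 1 1
    · linear_combination h₀ 0 0 0 1
    · linear_combination h₀ 1 0 1 1
    · linear_combination h₀ 0 0 1 0
    · linear_combination h₀ 0 1 1 1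
    · linear_combination h₃ 0 0 1 1
    · linear_combination h₂ 0 0 1 1
    · linear_combination h₀ 0 0 1 1
  · rintro ⟨⟨h1, h2, h3, h4, h5, h6⟩, h7, h8, h9⟩ i n m
    obtain ⟨a, b, c, rfl⟩ := exists_eq_idx n
    obtain ⟨a', b', c', rfl⟩ := exists_eq_idx m
    rcases eq_outer i with rfl | rfl | rfl <;>
    simp only [idx_o₀, idx_o₂, idx_o₃, update_idx_o₀, update_idx_o₂, update_idx_o₃] <;>
    fin_cases a <;> fin_cases a' <;> fin_cases b <;> fin_cases b' <;> fin_cases c <;>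
      fin_cases c' <;> simp only [Fin.zero_eta, Fin.mk_one, Fin.isValue] <;> grind

/-- The deviation of the second difference of the hyperdeterminant from `2 ⟨v, w⟩²`, as a
combination of the face minors of `w` and of the products of its coefficients along the diagonals
of the cube. The coefficients of this combination vanish if and only if `v` satisfies the
equations of `isPure_iff_minors`, when `2` is invertible. -/
theorem hyperdet_second_difference (v w : (Outer → Fin 2) → k) :
    hyperdet (w + v) + hyperdet (w - v) - 2 * hyperdet w - 2 * hyperdet v - 2 * symp v w ^ 2 =
      -8 * ((w (idx 0 0 0) * w (idx 0 1 1) - w (idx 0 0 1) * w (idx 0 1 0)) *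
        (v (idx 1 0 0) * v (idx 1 1 1) - v (idx 1 0 1) * v (idx 1 1 0))
      + (w (idx 1 0 0) * w (idx 1 1 1) - w (idx 1 0 1) * w (idx 1 1 0)) *
        (v (idx 0 0 0) * v (idx 0 1 1) - v (idx 0 0 1) * v (idx 0 1 0))
      + (w (idx 0 0 0) * w (idx 1 0 1) - w (idx 0 0 1) * w (idx 1 0 0)) *
        (v (idx 0 1 0) * v (idx 1 1 1) - v (idx 0 1 1) * v (idx 1 1 0))
      + (w (idx 0 1 0) * w (idx 1 1 1) - w (idx 0 1 1) * w (idx 1 1 0)) *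
        (v (idx 0 0 0) * v (idx 1 0 1) - v (idx 0 0 1) * v (idx 1 0 0))
      + (w (idx 0 0 0) * w (idx 1 1 0) - w (idx 0 1 0) * w (idx 1 0 0)) *
        (v (idx 0 0 1) * v (idx 1 1 1) - v (idx 0 1 1) * v (idx 1 0 1))
      + (w (idx 0 0 1) * w (idx 1 1 1) - w (idx 0 1 1) * w (idx 1 0 1)) *
        (v (idx 0 0 0) * v (idx 1 1 0) - v (idx 0 1 0) * v (idx 1 0 0)))
      + 4 * (w (idx 0 0 0) * w (idx 1 1 1)
        * (3 * (v (idx 0 0 0) * v (idx 1 1 1)) - v (idx 0 0 1) * v (idx 1 1 0)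
        - v (idx 0 1 0) * v (idx 1 0 1) - v (idx 1 0 0) * v (idx 0 1 1))
      + w (idx 0 0 1) * w (idx 1 1 0)
        * (3 * (v (idx 0 0 1) * v (idx 1 1 0)) - v (idx 0 0 0) * v (idx 1 1 1)
        - v (idx 0 1 0) * v (idx 1 0 1) - v (idx 1 0 0) * v (idx 0 1 1))
      + w (idx 0 1 0) * w (idx 1 0 1)
        * (3 * (v (idx 0 1 0) * v (idx 1 0 1)) - v (idx 0 0 0) * v (idx 1 1 1)
        - v (idx 0 0 1) * v (idx 1 1 0) - v (idx 1 0 0) * v (idx 0 1 1))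
      + w (idx 1 0 0) * w (idx 0 1 1)
        * (3 * (v (idx 1 0 0) * v (idx 0 1 1)) - v (idx 0 0 0) * v (idx 1 1 1)
        - v (idx 0 0 1) * v (idx 1 1 0) - v (idx 0 1 0) * v (idx 1 0 1))) := by
  simp only [hyperdet, symp, Pi.add_apply, Pi.sub_apply]
  ring

/-- Purity in terms of the two forms: the second difference of the hyperdeterminant at `v` is
`2 ⟨v, -⟩²`. Hence linear maps that preserve both forms preserve the pure tensors. -/
theorem isPure_iff (h2 : (2 : k) ≠ 0) (v : (Outer → Fin 2) → k) : IsPure v ↔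
    ∀ w, hyperdet (w + v) + hyperdet (w - v) - 2 * hyperdet w - 2 * hyperdet v =
      2 * symp v w ^ 2 := by
  rw [isPure_iff_minors]
  constructor
  · rintro ⟨⟨h1, h2, h3, h4, h5, h6⟩, h7, h8, h9⟩ w
    rw [← sub_eq_zero, hyperdet_second_difference]
    linear_combination -8 * ((w (idx 0 0 0) * w (idx 0 1 1) - w (idx 0 0 1) * w (idx 0 1 0)) * h2
      + (w (idx 1 0 0) * w (idx 1 1 1) - w (idx 1 0 1) * w (idx 1 1 0)) * h1
      + (w (idx 0 0 0) * w (idx 1 0 1) - w (idx 0 0 1) * w (idx 1 0 0)) * h4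
      + (w (idx 0 1 0) * w (idx 1 1 1) - w (idx 0 1 1) * w (idx 1 1 0)) * h3
      + (w (idx 0 0 0) * w (idx 1 1 0) - w (idx 0 1 0) * w (idx 1 0 0)) * h6
      + (w (idx 0 0 1) * w (idx 1 1 1) - w (idx 0 1 1) * w (idx 1 0 1)) * h5)
      + 4 * ((w (idx 0 0 0) * w (idx 1 1 1) + w (idx 0 0 1) * w (idx 1 1 0)
          + w (idx 0 1 0) * w (idx 1 0 1) + w (idx 1 0 0) * w (idx 0 1 1))
        * (h7 + h8 + h9) - 4 * (w (idx 0 0 1) * w (idx 1 1 0) * h7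
          + w (idx 0 1 0) * w (idx 1 0 1) * h8 + w (idx 1 0 0) * w (idx 0 1 1) * h9))
  · intro H
    have key := fun w => (sub_eq_zero.2 (H w)).symm.trans (hyperdet_second_difference v w)
    have h8 : (8 : k) ≠ 0 := by
      rw [show (8 : k) = 2 ^ 3 by norm_num]; exact pow_ne_zero _ h2
    have h4 : (4 : k) ≠ 0 := by
      rw [show (4 : k) = 2 ^ 2 by norm_num]; exact pow_ne_zero _ h2
    -- each face minor of `v` is tested by an array `w` whose only nonzero face minor is the
    -- opposite one; the products along the diagonals are tested by the sums of two opposite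
    -- basis tensors
    have f0 := key (arr ![![![0, 0], ![0, 0]], ![![1, 0], ![0, 1]]])
    have f1 := key (arr ![![![1, 0], ![0, 1]], ![![0, 0], ![0, 0]]])
    have f2 := key (arr ![![![0, 0], ![1, 0]], ![![0, 0], ![0, 1]]])
    have f3 := key (arr ![![![1, 0], ![0, 0]], ![![0, 1], ![0, 0]]])
    have f4 := key (arr ![![![0, 1], ![0, 0]], ![![0, 0], ![0, 1]]])
    have f5 := key (arr ![![![1, 0], ![0, 0]], ![![0, 0], ![1, 0]]])
    have a0 := key (arr ![![![1, 0], ![0, 0]], ![![0, 0], ![0, 1]]])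
    have a1 := key (arr ![![![0, 1], ![0, 0]], ![![0, 0], ![1, 0]]])
    have a2 := key (arr ![![![0, 0], ![1, 0]], ![![0, 1], ![0, 0]]])
    have a3 := key (arr ![![![0, 0], ![0, 1]], ![![1, 0], ![0, 0]]])
    simp [arr_idx, h8, h4] at f0 f1 f2 f3 f4 f5 a0 a1 a2 a3
    refine ⟨⟨sub_eq_zero.1 f0, sub_eq_zero.1 f1, sub_eq_zero.1 f2, sub_eq_zero.1 f3,
      sub_eq_zero.1 f4, sub_eq_zero.1 f5⟩, ?_, ?_, ?_⟩ <;> apply mul_left_cancel₀ h4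
    · linear_combination a0 - a1
    · linear_combination a0 - a2
    · linear_combination a0 - a3

end

end ChevalleyBasisD4

/-! ### The stabilizer of the hyperdeterminant and the symplectic form -/

namespace ChevalleyBasisD4

/-- The index `m` with its `i`-th entry changed. -/
def flip {ι : Type*} [DecidableEq ι] (m : ι → Fin 2) (i : ι) : ι → Fin 2 :=
  Function.update m i (m i + 1)

/-- A pure tensor `w`, without component along the basis tensor `e_m`, for which `e_m + w` is pure,
is a multiple of a basis tensor adjacent to `e_m`. -/
theorem IsPure.exists_eq_smul_single {ι k : Type*} [Fintype ι] [DecidableEq ι] [Field k]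
    {w : (ι → Fin 2) → k} {m : ι → Fin 2} (hw : IsPure w) (h : IsPure (Pi.single m 1 + w))
    (hm : w m = 0) (h0 : w ≠ 0) : ∃ i, ∃ c : k, c ≠ 0 ∧ w = c • Pi.single (flip m i) 1 := by
  have hne : ∀ n, n ≠ m → (Pi.single m 1 + w : (ι → Fin 2) → k) n = w n := fun n hn => by
    simp [Pi.single_eq_of_ne hn]
  have hmm : (Pi.single m 1 + w : (ι → Fin 2) → k) m = 1 := by simp [hm]
  have hfin : ∀ a b : Fin 2, a ≠ b → a = b + 1 := by decide
  -- if `n` differs from `m` in at least two places, the minor through `n` and `m` changes by `w n`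
  -- from `w` to `e_m + w`
  have hfar : ∀ n, (∀ i, n ≠ flip m i) → w n = 0 := fun n hn => by
    by_cases hnm : n = m
    · rw [hnm, hm]
    obtain ⟨i, hi⟩ := Function.ne_iff.1 hnm
    have h1 : Function.update m i (n i) ≠ m := fun e => hi (by simpa using congrFun e i)
    have h3 : Function.update n i (m i) ≠ m := fun e => by
      refine hn i ?_
      rw [flip, ← hfin _ _ hi]
      funext j
      by_cases hj : j = i
      · subst hj; simp
      · have := congrFun e j
        rwa [Function.update_of_ne hj] at this ⊢
    have e1 := h i m n
    rw [hmm, one_mul, hne n hnm, hne _ h1, hne _ h3, ← hw i m n, hm, zero_mul] at e1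
    exact e1
  -- two indices adjacent to `m` lie on a face through `m`
  have hnear : ∀ i j, i ≠ j → w (flip m i) = 0 ∨ w (flip m j) = 0 := fun i j hij => by
    have e := hw i (flip m i) (flip m j)
    have e' : Function.update (flip m i) i (flip m j i) = m := by
      simp [flip, Function.update_of_ne hij]
    rw [e', hm, zero_mul] at e
    exact mul_eq_zero.1 e
  obtain ⟨n, hn⟩ := Function.ne_iff.1 h0
  obtain ⟨i, rfl⟩ : ∃ i, n = flip m i := by
    by_contra! hc
    exact hn (hfar n hc)
  refine ⟨i, w (flip m i), hn, funext fun n => ?_⟩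
  by_cases hni : n = flip m i
  · simp [hni]
  · rw [Pi.smul_apply, Pi.single_eq_of_ne hni, smul_zero]
    by_cases hj : ∃ j, n = flip m j
    · obtain ⟨j, rfl⟩ := hj
      exact (hnear i j fun e => hni (e ▸ rfl)).resolve_left hn
    · exact hfar n (by simpa using hj)

/-- A pure tensor is a product of vectors: the factors are read off, up to
normalization, from the entries adjacent to a nonzero entry. -/
theorem IsPure.exists_eq_prod {k : Type*} [Field k] {v : (Outer → Fin 2) → k} (h : IsPure v) :
    ∃ u : Outer → Fin 2 → k, ∀ n, v n = ∏ i, u i (n i) := by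
  by_cases h0 : v = 0
  · exact ⟨0, fun n => by simp [h0]⟩
  obtain ⟨m, hm⟩ := Function.ne_iff.1 h0
  refine ⟨fun i a => v (Function.update m i a) * if i = o₀ then (v m ^ 2)⁻¹ else 1, fun n => ?_⟩
  have h1 := h o₀ n m
  have h3 := h o₂ (Function.update n o₀ (m o₀)) m
  obtain ⟨a, b, c, rfl⟩ := exists_eq_idx n
  obtain ⟨a', b', c', rfl⟩ := exists_eq_idx m
  simp only [idx_o₀, idx_o₂, update_idx_o₀, update_idx_o₂] at h1 h3
  have e : o₂ ≠ o₀ ∧ o₃ ≠ o₀ := by decide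
  simp only [prod_outer, idx_o₀, idx_o₂, idx_o₃, update_idx_o₀, update_idx_o₂, update_idx_o₃,
    if_true, if_neg e.1, if_neg e.2]
  rw [Pi.zero_apply] at hm
  field_simp
  linear_combination v (idx a' b' c') * h1 + v (idx a b' c') * h3

section

variable {k : Type*} [Field k]

theorem idx_inj {a b c a' b' c' : Fin 2} :
    idx a b c = idx a' b' c' ↔ a = a' ∧ b = b' ∧ c = c' :=
  ⟨fun h => ⟨congrFun h o₀, congrFun h o₂, congrFun h o₃⟩, by rintro ⟨rfl, rfl, rfl⟩; rfl⟩

theorem zero_eq_idx : (0 : Outer → Fin 2) = idx 0 0 0 := by decide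
theorem one_eq_idx : (1 : Outer → Fin 2) = idx 1 1 1 := by decide
theorem flip_zero_o₀ : flip 0 o₀ = idx 1 0 0 := by decide
theorem flip_zero_o₂ : flip 0 o₂ = idx 0 1 0 := by decide
theorem flip_zero_o₃ : flip 0 o₃ = idx 0 0 1 := by decide
theorem flip_one_o₀ : flip 1 o₀ = idx 0 1 1 := by decide
theorem flip_one_o₂ : flip 1 o₂ = idx 1 0 1 := by decide
theorem flip_one_o₃ : flip 1 o₃ = idx 1 1 0 := by decide

theorem flip_injective (m : Outer → Fin 2) : Function.Injective (flip m) := by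
  revert m; decide

theorem eq_flip (n : Outer → Fin 2) :
    n = 0 ∨ n = 1 ∨ (∃ i, n = flip 0 i) ∨ ∃ i, n = flip 1 i := by
  revert n; decide

theorem isPure_single (n : Outer → Fin 2) : IsPure (Pi.single n 1 : (Outer → Fin 2) → k) := by
  obtain ⟨a, b, c, rfl⟩ := exists_eq_idx n
  rw [isPure_iff_minors]
  fin_cases a <;> fin_cases b <;> fin_cases c <;> simp [idx_inj]

theorem isPure_single_add_single (n : Outer → Fin 2) (i : Outer) :
    IsPure (Pi.single n 1 + Pi.single (flip n i) 1 : (Outer → Fin 2) → k) := by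
  obtain ⟨a, b, c, rfl⟩ := exists_eq_idx n
  rw [isPure_iff_minors]
  rcases eq_outer i with rfl | rfl | rfl <;>
  simp only [flip, idx_o₀, idx_o₂, idx_o₃, update_idx_o₀, update_idx_o₂, update_idx_o₃] <;>
  fin_cases a <;> fin_cases b <;> fin_cases c <;> simp [idx_inj]

theorem symp_zero_left (w : (Outer → Fin 2) → k) : symp (Pi.single 0 1) w = w 1 := by
  simp [symp, zero_eq_idx, one_eq_idx, idx_inj]

theorem symp_one_left (w : (Outer → Fin 2) → k) : symp (Pi.single 1 1) w = -w 0 := by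
  simp [symp, zero_eq_idx, one_eq_idx, idx_inj]

theorem symp_flip_zero_left (i : Outer) (w : (Outer → Fin 2) → k) :
    symp (Pi.single (flip 0 i) 1) w = -w (flip 1 i) := by
  rcases eq_outer i with rfl | rfl | rfl <;>
  simp [symp, flip_zero_o₀, flip_zero_o₂, flip_zero_o₃, flip_one_o₀, flip_one_o₂, flip_one_o₃,
    idx_inj]

theorem symp_smul_left (c : k) (v w : (Outer → Fin 2) → k) : symp (c • v) w = c * symp v w := by
  simp only [symp, Pi.smul_apply, smul_eq_mul]; ring

theorem isPure_map (h2 : (2 : k) ≠ 0) {g : Module.End k ((Outer → Fin 2) → k)}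
    (hg : Function.Surjective g) (hq : ∀ v, hyperdet (g v) = hyperdet v)
    (hs : ∀ v w, symp (g v) (g w) = symp v w) {v : (Outer → Fin 2) → k} (hv : IsPure v) :
    IsPure (g v) := by
  rw [isPure_iff h2] at hv ⊢
  intro w
  obtain ⟨w, rfl⟩ := hg w
  rw [hs, ← map_add, ← map_sub, hq, hq, hq, hq, hv]

theorem tensorMap_diagonal_single (c : Outer → k) (n : Outer → Fin 2) :
    tensorMap (fun i => Matrix.diagonal ![1, c i]) (Pi.single n 1) =
      (∏ i, ![1, c i] (n i)) • Pi.single n 1 := by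
  ext m
  rw [tensorMap_single, Pi.smul_apply, Pi.single_apply]
  split_ifs with h
  · subst h; simp
  · obtain ⟨i, hi⟩ := Function.ne_iff.1 h
    rw [Finset.prod_eq_zero (Finset.mem_univ i) ?_, smul_zero]
    exact Matrix.diagonal_apply_ne _ hi

/-- The hyperdeterminant detects the product of the scalars by which the three basis tensors
adjacent to `e_0` are multiplied. -/
theorem hyperdet_one_add (c : Outer → k) :
    hyperdet (Pi.single 1 1 + ∑ i, c i • Pi.single (flip 0 i) 1) = 4 * ∏ i, c i := by
  simp [hyperdet, sum_outer, prod_outer, one_eq_idx, flip_zero_o₀, flip_zero_o₂, flip_zero_o₃,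
    idx_inj, -mul_eq_mul_left_iff]
  ring

theorem flip_zero_comp (σ : Equiv.Perm Outer) (i : Outer) : flip 0 i ∘ σ.symm = flip 0 (σ i) := by
  revert σ i; decide

theorem flip_one_comp (σ : Equiv.Perm Outer) (i : Outer) : flip 1 i ∘ σ.symm = flip 1 (σ i) := by
  revert σ i; decide

/-- An element of the stabilizer that fixes two opposite basis tensors permutes the three basis
tensors adjacent to either of them, up to scalars. -/
theorem exists_eq_diagonal_mul_permMap (h2 : (2 : k) ≠ 0) (g : Module.End k ((Outer → Fin 2) → k))
    (hp : ∀ v, IsPure v → IsPure (g v)) (hq : ∀ v, hyperdet (g v) = hyperdet v)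
    (hs : ∀ v w, symp (g v) (g w) = symp v w) (h0 : g (Pi.single 0 1) = Pi.single 0 1)
    (h1 : g (Pi.single 1 1) = Pi.single 1 1) :
    ∃ (c : Outer → k) (σ : Equiv.Perm Outer), ∏ i, c i = 1 ∧
      g = tensorMap (fun i => Matrix.diagonal ![1, c i]) * permMap k σ := by
  have hne : ∀ i, (0 : Outer → Fin 2) ≠ flip 0 i ∧ (0 : Outer → Fin 2) ≠ flip 1 i ∧
    (1 : Outer → Fin 2) ≠ flip 0 i ∧ (1 : Outer → Fin 2) ≠ flip 1 i := by decide
  have hpair : ∀ i j, symp (g (Pi.single (flip 0 i) 1)) (g (Pi.single (flip 1 j) 1)) =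
      -(if i = j then 1 else 0) := fun i j => by
    rw [hs, symp_flip_zero_left, Pi.single_apply]
    simp only [(flip_injective 1).eq_iff]
  -- `g` maps `e_(flip 0 i)` to a pure tensor `w` orthogonal to `e_1` such that `e_0 + w` is pure
  have hE : ∀ i, ∃ j, ∃ c : k, c ≠ 0 ∧ g (Pi.single (flip 0 i) 1) = c • Pi.single (flip 0 j) 1 := by
    intro i
    refine (hp _ (isPure_single _)).exists_eq_smul_single ?_ ?_ fun e => ?_
    · rw [← h0, ← map_add]; exact hp _ (isPure_single_add_single 0 i)
    · rw [← neg_eq_zero, ← symp_one_left, ← h1, hs, symp_one_left,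
        Pi.single_eq_of_ne (hne i).1, neg_zero]
    · have := hpair i i
      rw [e, ← zero_smul k (0 : (Outer → Fin 2) → k), symp_smul_left] at this
      simp at this
  have hF : ∀ i, ∃ j, ∃ c : k, c ≠ 0 ∧ g (Pi.single (flip 1 i) 1) = c • Pi.single (flip 1 j) 1 := by
    intro i
    refine (hp _ (isPure_single _)).exists_eq_smul_single ?_ ?_ fun e => ?_
    · rw [← h1, ← map_add]; exact hp _ (isPure_single_add_single 1 i)
    · rw [← symp_zero_left (g _), ← h0, hs, symp_zero_left, Pi.single_eq_of_ne (hne i).2.2.2]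
    · have := hpair i i
      rw [e] at this
      simp [symp] at this
  choose f c hc hgE using hE
  choose f' c' hc' hgF using hF
  -- `g` preserves the pairing of the tensors adjacent to `e_0` with those adjacent to `e_1`
  have hcc : ∀ i j, c i * (c' j * if f i = f' j then 1 else 0) = if i = j then 1 else 0 := by
    intro i j
    have := hpair i j
    rw [hgE, hgF, symp_smul_left, symp_flip_zero_left, Pi.smul_apply, Pi.single_apply,
      smul_eq_mul] at this
    simp only [(flip_injective 1).eq_iff] at this
    linear_combination -this
  have hff : ∀ i j, f i = f' j ↔ i = j := fun i j => by
    have := hcc i j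
    constructor
    · intro e
      by_contra hij
      simp [e, hij, hc, hc'] at this
    · intro e
      by_contra hij
      simp [e ▸ hij, e] at this
  have hf' : f' = f := funext fun i => ((hff i i).2 rfl).symm
  subst hf'
  have hcc' : ∀ i, c i * c' i = 1 := fun i => by simpa using hcc i i
  let σ : Equiv.Perm Outer := Equiv.ofBijective f'
    (Finite.injective_iff_bijective.1 fun i j e => (hff i j).1 e)
  have hσ : ∀ i, f' i = σ i := fun _ => rfl
  have hprod : ∏ i, c (σ.symm i) = 1 := by
    have h4 : (4 : k) ≠ 0 := by
      rw [show (4 : k) = 2 ^ 2 by norm_num]; exact pow_ne_zero _ h2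
    have e := hq (Pi.single 1 1 + ∑ i, (1 : k) • Pi.single (flip 0 i) 1)
    have e' : ∑ i, g ((1 : k) • Pi.single (flip 0 i) 1) =
        ∑ i, c (σ.symm i) • Pi.single (flip 0 i) 1 := by
      rw [← Equiv.sum_comp σ.symm]
      simp only [one_smul, hgE, hσ, Equiv.apply_symm_apply]
    rw [hyperdet_one_add, map_add, map_sum, h1, e', Finset.prod_const_one] at e
    rw [hyperdet_one_add] at e
    exact mul_left_cancel₀ h4 e
  refine ⟨fun i => c (σ.symm i), σ, hprod, LinearMap.pi_ext' fun n => LinearMap.ext_ring ?_⟩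
  rw [LinearMap.comp_apply, LinearMap.comp_apply, LinearMap.single_apply, Module.End.mul_apply,
    permMap_single, tensorMap_diagonal_single]
  rcases eq_flip n with rfl | rfl | ⟨i, rfl⟩ | ⟨i, rfl⟩
  · rw [h0]
    simp [show (0 : Outer → Fin 2) ∘ σ.symm = 0 from rfl]
  · rw [h1, show (1 : Outer → Fin 2) ∘ σ.symm = 1 from rfl]
    simp [hprod]
  · rw [hgE, hσ, flip_zero_comp]
    congr 1
    rw [Finset.prod_eq_single (σ i) (fun j _ hj => by simp [flip, Function.update_of_ne hj])
      (by simp)]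
    simp [flip]
  · rw [hgF, hσ, flip_one_comp]
    congr 1
    apply mul_left_cancel₀ (hc i)
    have e : ∏ j ∈ Finset.univ.erase (σ i), ![1, c (σ.symm j)] (flip 1 (σ i) j) =
        ∏ j ∈ Finset.univ.erase (σ i), c (σ.symm j) :=
      Finset.prod_congr rfl fun j hj => by
        simp [flip, Function.update_of_ne (Finset.ne_of_mem_erase hj)]
    have e' := Finset.mul_prod_erase Finset.univ (fun j => c (σ.symm j)) (Finset.mem_univ (σ i))
    have hi : ![1, c (σ.symm (σ i))] (flip 1 (σ i) (σ i)) = 1 := by simp [flip]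
    rw [Equiv.symm_apply_apply, hprod] at e'
    rw [hcc', ← Finset.mul_prod_erase _ _ (Finset.mem_univ (σ i)), e, hi, one_mul, e']

/-- The stabilizer of the two forms, over any field of characteristic not `2`: its elements are
the maps `⨂ A i` with `∏ det (A i) = 1`, composed with permutations of the factors. -/
theorem exists_eq_tensorMap_mul_permMap (h2 : (2 : k) ≠ 0)
    (g : Module.End k ((Outer → Fin 2) → k)) (hg : Function.Surjective g)
    (hq : ∀ v, hyperdet (g v) = hyperdet v) (hs : ∀ v w, symp (g v) (g w) = symp v w) :
    ∃ (A : Outer → Matrix (Fin 2) (Fin 2) k) (σ : Equiv.Perm Outer),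
      ∏ i, (A i).det = 1 ∧ g = tensorMap A * permMap k σ := by
  obtain ⟨u, hu⟩ := (isPure_map h2 hg hq hs (isPure_single 0)).exists_eq_prod
  obtain ⟨w, hw⟩ := (isPure_map h2 hg hq hs (isPure_single 1)).exists_eq_prod
  -- the tensor product of the maps with columns `u i` and `w i` agrees with `g` on the two
  -- opposite basis tensors
  let A : Outer → Matrix (Fin 2) (Fin 2) k := fun i => !![u i 0, w i 0; u i 1, w i 1]
  have hA : ∀ i a, A i a 0 = u i a ∧ A i a 1 = w i a := fun i a => by
    fin_cases a <;> exact ⟨rfl, rfl⟩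
  have hA0 : tensorMap A (Pi.single 0 1) = g (Pi.single 0 1) := funext fun n => by
    rw [tensorMap_single, hu]
    exact Finset.prod_congr rfl fun i _ => (hA i _).1
  have hA1 : tensorMap A (Pi.single 1 1) = g (Pi.single 1 1) := funext fun n => by
    rw [tensorMap_single, hw]
    exact Finset.prod_congr rfl fun i _ => (hA i _).2
  have hdet : ∏ i, (A i).det = 1 := by
    have e := symp_tensorMap A (Pi.single 0 1) (Pi.single 1 1)
    rw [hA0, hA1, hs, symp_zero_left, Pi.single_eq_same, mul_one] at e
    exact e.symm
  have hunit : ∀ i, IsUnit (A i).det := fun i =>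
    isUnit_of_dvd_one (hdet ▸ Finset.dvd_prod_of_mem _ (Finset.mem_univ i))
  let B : Outer → Matrix (Fin 2) (Fin 2) k := fun i => (A i)⁻¹
  have hAB : tensorMap A * tensorMap B = 1 := by
    rw [← tensorMap_mul, ← tensorMap_one]
    congr 1
    exact funext fun i => Matrix.mul_nonsing_inv _ (hunit i)
  have hBA : tensorMap B * tensorMap A = 1 := by
    rw [← tensorMap_mul, ← tensorMap_one]
    congr 1
    exact funext fun i => Matrix.nonsing_inv_mul _ (hunit i)
  have hdetB : ∏ i, (B i).det = 1 := by
    simp only [B, Matrix.det_nonsing_inv, Ring.inverse_eq_inv', Finset.prod_inv_distrib, hdet,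
      inv_one]
  have hB : ∀ v, tensorMap B (tensorMap A v) = v := fun v => by
    rw [← Module.End.mul_apply, hBA, Module.End.one_apply]
  have hqB : ∀ v, hyperdet ((tensorMap B * g) v) = hyperdet v := fun v => by
    rw [Module.End.mul_apply, hyperdet_tensorMap, hdetB, hq]; ring
  have hsB : ∀ v w, symp ((tensorMap B * g) v) ((tensorMap B * g) w) = symp v w := fun v w => by
    rw [Module.End.mul_apply, Module.End.mul_apply, symp_tensorMap, hdetB, hs, one_mul]
  have hgB : Function.Surjective (tensorMap B * g) := fun v => by
    obtain ⟨v', hv'⟩ := hg (tensorMap A v)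
    exact ⟨v', by rw [Module.End.mul_apply, hv', hB]⟩
  obtain ⟨c, σ, hc, e⟩ := exists_eq_diagonal_mul_permMap h2 (tensorMap B * g)
    (fun v hv => isPure_map h2 hgB hqB hsB hv) hqB hsB
    (by rw [Module.End.mul_apply, ← hA0, hB]) (by rw [Module.End.mul_apply, ← hA1, hB])
  refine ⟨A * fun i => Matrix.diagonal ![1, c i], σ, ?_, ?_⟩
  · simp [Finset.prod_mul_distrib, hdet, hc]
  · rw [tensorMap_mul, mul_assoc, ← e, ← mul_assoc, hAB, one_mul]

/-- Over an algebraically closed field, the factors of `⨂ A i` can be taken in `SL₂` when the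
determinants of the `A i` have product `1`. -/
theorem exists_tensorMap_eq_specialLinear [IsAlgClosed k]
    (A : Outer → Matrix (Fin 2) (Fin 2) k) (hA : ∏ i, (A i).det = 1) :
    ∃ s : SL2Cubed k, tensorMap (fun i => (s i : Matrix (Fin 2) (Fin 2) k)) = tensorMap A := by
  obtain ⟨a, ha, hprod⟩ : ∃ a : Outer → k, (∀ i, (A i).det = a i ^ 2) ∧ ∏ i, a i = 1 := by
    obtain ⟨b, hb⟩ := IsAlgClosed.exists_pow_nat_eq (A o₂).det (n := 2) (by norm_num)
    obtain ⟨c, hc⟩ := IsAlgClosed.exists_pow_nat_eq (A o₃).det (n := 2) (by norm_num)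
    rw [prod_outer, ← hb, ← hc] at hA
    have hb0 : b ≠ 0 := by rintro rfl; simp at hA
    have hc0 : c ≠ 0 := by rintro rfl; simp at hA
    refine ⟨fun i => ![(b * c)⁻¹, 0, b, c] i.1, fun i => ?_, ?_⟩
    · rcases eq_outer i with rfl | rfl | rfl
      · change _ = (b * c)⁻¹ ^ 2
        field_simp
        linear_combination hA
      · exact hb.symm
      · exact hc.symm
    · rw [prod_outer]
      change (b * c)⁻¹ * b * c = 1
      field_simp
  have ha0 : ∀ i, a i ≠ 0 := fun i => by
    have : a i ∣ 1 := hprod ▸ Finset.dvd_prod_of_mem _ (Finset.mem_univ i)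
    exact (isUnit_of_dvd_one this).ne_zero
  refine ⟨fun i => ⟨(a i)⁻¹ • A i, ?_⟩, ?_⟩
  · rw [Matrix.det_smul, ha, Fintype.card_fin, ← mul_pow, inv_mul_cancel₀ (ha0 i), one_pow]
  · change tensorMap (fun i => (a i)⁻¹ • A i) = _
    rw [tensorMap_smul, Finset.prod_inv_distrib, hprod, inv_one, one_smul]

end

end ChevalleyBasisD4

/-! ### The space `𝔤₁` as a space of tensors -/

namespace ChevalleyBasisD4

open RootD4

/-- The roots of height one: the coefficient on `αᵢ` is `1 - n i`, so that the first basis vector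
of the `i`-th factor `k²` corresponds to the roots with a component along `αᵢ`. -/
def root (n : Outer → Fin 2) : RootD4 :=
  ⟨![1 - (n o₀ : ℤ), 1, 1 - (n o₂ : ℤ), 1 - (n o₃ : ℤ)], by revert n; decide⟩

theorem exists_eq_root (β : RootD4) (h : β.height = 1) : ∃ n, β = root n := by
  revert β; decide +kernel

theorem root_injective : Function.Injective root := by decide +kernel

/-- The signs `s β` bring the structure constants to the form `eps`, in the sense of
`exists_sign`. -/
structure IsNormalizing {F L : Type*} [Field F] [LieRing L] [LieAlgebra F L]
    (C : ChevalleyBasisD4 F L) (s : RootD4 → ℤˣ) : Prop where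
  simple : ∀ i, s (simple i) = 1
  opp : ∀ β, s β.opp = -s β
  c_eq : ∀ β γ δ : RootD4, β.coeff + γ.coeff = δ.coeff →
    C.c β γ = (eps β.coeff γ.coeff * (s β * s γ * s δ) : ℤˣ)

section

variable {F L : Type*} [Field F] [LieRing L] [LieAlgebra F L] (C : ChevalleyBasisD4 F L)
  (s : RootD4 → ℤˣ)

/-- The Chevalley basis with the root vectors `x_β` rescaled by the signs `s β`. -/
noncomputable def signedBasis : Module.Basis (Fin 4 ⊕ RootD4) F L :=
  C.basis.unitsSMul (Sum.elim 1 fun β => Units.map (Int.castRingHom F).toMonoidHom (s β))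

/-- The rescaled root vectors `y_β = s β • x_β`. -/
noncomputable def y (β : RootD4) : L := C.signedBasis s (Sum.inr β)

theorem signedBasis_inl (i : Fin 4) : C.signedBasis s (Sum.inl i) = C.basis (Sum.inl i) := by
  simp [signedBasis, Module.Basis.unitsSMul_apply]

theorem y_eq (β : RootD4) : C.y s β = ((s β : ℤ) : F) • C.x β := by
  simp [y, signedBasis, Module.Basis.unitsSMul_apply, x, Units.smul_def]

theorem sign_mul_self (u : ℤˣ) : ((u : ℤ) : F) * ((u : ℤ) : F) = 1 := by
  rcases Int.units_eq_one_or u with rfl | rfl <;> simp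

theorem x_eq (β : RootD4) : C.x β = ((s β : ℤ) : F) • C.y s β := by
  rw [y_eq, smul_smul, sign_mul_self, one_smul]

variable {C s} (h : IsNormalizing C s)
include h

theorem IsNormalizing.x_simple (i : Fin 4) : C.x (RootD4.simple i) = C.y s (RootD4.simple i) := by
  rw [C.x_eq s, h.simple]; simp

theorem IsNormalizing.x_simple_opp (i : Fin 4) :
    C.x (RootD4.simple i).opp = -C.y s (RootD4.simple i).opp := by
  rw [C.x_eq s, h.opp, h.simple]; simp

theorem IsNormalizing.lie_y_add {β γ δ : RootD4} (hδ : β.coeff + γ.coeff = δ.coeff) :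
    ⁅C.y s β, C.y s γ⁆ = ((eps β.coeff γ.coeff : ℤ) : F) • C.y s δ := by
  rw [y_eq, y_eq, smul_lie, lie_smul, C.lie_x_add hδ, h.c_eq β γ δ hδ, C.x_eq s δ, smul_smul,
    smul_smul, smul_smul]
  congr 1
  push_cast
  linear_combination (((eps β.coeff γ.coeff : ℤ) : F)) *
    (((s γ : ℤ) : F) * ((s γ : ℤ) : F) * (((s δ : ℤ) : F) * ((s δ : ℤ) : F)) *
      sign_mul_self (F := F) (s β) + (((s δ : ℤ) : F) * ((s δ : ℤ) : F)) *
      sign_mul_self (F := F) (s γ) + sign_mul_self (F := F) (s δ))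

theorem IsNormalizing.lie_y_opp (β : RootD4) :
    ⁅C.y s β, C.y s β.opp⁆ = -∑ i, (β.coeff i : F) • C.basis (Sum.inl i) := by
  rw [y_eq, y_eq, smul_lie, lie_smul, C.lie_x_opp', smul_smul, h.opp]
  push_cast
  rw [mul_neg, sign_mul_self, neg_smul, one_smul]

omit h in
theorem lie_y_of_pairing_nonneg {β γ : RootD4} (hβ : 0 ≤ β.pairing γ) :
    ⁅C.y s β, C.y s γ⁆ = 0 := by
  have : β.coeff + γ.coeff ≠ 0 ∧ ∀ δ : RootD4, β.coeff + γ.coeff ≠ δ.coeff := by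
    revert β γ; decide +kernel
  rw [y_eq, y_eq, smul_lie, lie_smul, x, x, C.lie_x_x_zero β γ this.1 this.2, smul_zero, smul_zero]

omit h in
theorem lie_h_y (i : Fin 4) (β : RootD4) : ⁅C.basis (Sum.inl i), C.y s β⁆ =
    (β.pairing (RootD4.simple i) : F) • C.y s β := by
  rw [y_eq, lie_smul, x, C.lie_h_x, smul_comm]

omit h in
theorem lie_coroot_y (β γ : RootD4) :
    ⁅∑ i, (β.coeff i : F) • C.basis (Sum.inl i), C.y s γ⁆ = (β.pairing γ : F) • C.y s γ := by
  rw [y_eq, lie_smul, C.lie_coroot_x, smul_comm]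

variable (C s)

omit h in
theorem y_root_mem (n : Outer → Fin 2) : C.y s (root n) ∈ C.g₁ := by
  rw [y_eq]
  exact Submodule.smul_mem _ _ (Submodule.subset_span ⟨_, rfl, rfl⟩)

/-- The basis of `𝔤₁` that identifies it with `k² ⊗ k² ⊗ k²`. -/
noncomputable def g₁Basis : Module.Basis (Outer → Fin 2) F C.g₁ :=
  Module.Basis.mk (v := fun n => (⟨C.y s (root n), C.y_root_mem s n⟩ : C.g₁))
    (LinearIndependent.of_comp C.g₁.subtype
      ((C.signedBasis s).linearIndependent.comp (fun n => Sum.inr (root n))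
        (Sum.inr_injective.comp root_injective)))
    (by
      rintro ⟨v, hv⟩ -
      induction hv using Submodule.span_induction with
      | mem v hv =>
        obtain ⟨i | β, hj, rfl⟩ := hv
        · simp [degree] at hj
        · obtain ⟨n, rfl⟩ := exists_eq_root β hj
          have : (⟨C.basis (Sum.inr (root n)), Submodule.subset_span ⟨_, hj, rfl⟩⟩ : C.g₁) =
              ((s (root n) : ℤ) : F) • ⟨C.y s (root n), C.y_root_mem s n⟩ :=
            Subtype.ext (C.x_eq s (root n))
          rw [this]
          exact Submodule.smul_mem _ _ (Submodule.subset_span ⟨n, rfl⟩)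
      | zero => exact Submodule.zero_mem _
      | add a b ha hb ha' hb' => exact Submodule.add_mem _ ha' hb'
      | smul t a ha ha' => exact Submodule.smul_mem _ t ha')

omit h in
theorem coe_g₁Basis (n : Outer → Fin 2) : (C.g₁Basis s n : L) = C.y s (root n) := by
  rw [g₁Basis, Module.Basis.mk_apply]

/-- The identification of `𝔤₁` with `k² ⊗ k² ⊗ k²`. -/
noncomputable def toTensor : C.g₁ ≃ₗ[F] ((Outer → Fin 2) → F) := (C.g₁Basis s).equivFun

omit h in
theorem coe_eq_sum (v : C.g₁) : (v : L) = ∑ n, C.toTensor s v n • C.y s (root n) := by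
  conv_lhs => rw [← (C.g₁Basis s).sum_equivFun v]
  rw [AddSubmonoidClass.coe_finsetSum]
  exact Finset.sum_congr rfl fun n _ => by
    rw [Submodule.coe_smul, coe_g₁Basis]; rfl

omit h in
theorem toTensor_g₁Basis (n : Outer → Fin 2) : C.toTensor s (C.g₁Basis s n) = Pi.single n 1 := by
  rw [toTensor, Module.Basis.equivFun_apply, Module.Basis.repr_self]
  exact Finsupp.single_eq_pi_single _ _

variable {C s}

/-- The root vectors of the outer simple roots act on `𝔤₁` as the raising operators. -/
theorem IsNormalizing.lie_simple_root (i : Outer) (n : Outer → Fin 2) :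
    ⁅C.x (RootD4.simple i), C.y s (root n)⁆ =
      if n i = 1 then C.y s (root (Function.update n i 0)) else 0 := by
  rw [h.x_simple]
  split_ifs with hn
  · have h1 : (RootD4.simple i).coeff + (root n).coeff =
        (root (Function.update n i 0)).coeff := by revert n i; decide +kernel
    have h2 : eps (RootD4.simple i).coeff (root n).coeff = 1 := by revert n i; decide +kernel
    rw [h.lie_y_add h1, h2]
    simp
  · exact lie_y_of_pairing_nonneg (by revert n i; decide +kernel)

/-- The root vectors of the opposites of the outer simple roots act on `𝔤₁` as the lowering
operators. -/
theorem IsNormalizing.lie_simple_opp_root (i : Outer) (n : Outer → Fin 2) :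
    ⁅C.x (RootD4.simple i).opp, C.y s (root n)⁆ =
      if n i = 0 then C.y s (root (Function.update n i 1)) else 0 := by
  rw [h.x_simple_opp, neg_lie]
  split_ifs with hn
  · have h1 : (RootD4.simple i).opp.coeff + (root n).coeff =
        (root (Function.update n i 1)).coeff := by revert n i; decide +kernel
    have h2 : eps (RootD4.simple i).opp.coeff (root n).coeff = -1 := by
      revert n i; decide +kernel
    rw [h.lie_y_add h1, h2]
    simp
  · rw [lie_y_of_pairing_nonneg (by revert n i; decide +kernel), neg_zero]

omit h in
theorem tensorMap_mulSingle_single {ι k : Type*} [Fintype ι] [DecidableEq ι] [CommRing k] (i : ι)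
    (M : Matrix (Fin 2) (Fin 2) k) (n : ι → Fin 2) :
    tensorMap (Pi.mulSingle i M) (Pi.single n 1) =
      ∑ a, M a (n i) • Pi.single (Function.update n i a) 1 := by
  ext m
  rw [tensorMap_mulSingle, Finset.sum_apply]
  simp only [Pi.smul_apply, Pi.single_apply, smul_eq_mul, mul_ite, mul_one, mul_zero]
  have : ∀ b, Function.update m i b = n ↔ b = n i ∧ m = Function.update n i (m i) := fun b => by
    constructor
    · rintro rfl; simp
    · rintro ⟨rfl, h⟩; rw [h]; simp
  have h' : ∀ b, m = Function.update n i b ↔ b = m i ∧ m = Function.update n i (m i) := fun b => by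
    constructor
    · intro h; rw [h]; simp
    · rintro ⟨rfl, h⟩; exact h
  generalize (m = Function.update n i (m i)) = P at this h'
  classical
  rw [Finset.sum_congr rfl fun b _ => if_congr (this b) rfl rfl,
    Finset.sum_congr rfl fun b _ => if_congr (h' b) rfl rfl]
  by_cases hP : P <;> simp [hP]

/-- The operator `exp (t ad x_β)` of `expAd`, as a linear map. -/
noncomputable def expAdLinear (C : ChevalleyBasisD4 F L) (β : RootD4) (t : F) : L →ₗ[F] L :=
  LinearMap.id + t • LieAlgebra.ad F L (C.x β) +
    (t ^ 2 / 2) • (LieAlgebra.ad F L (C.x β) ∘ₗ LieAlgebra.ad F L (C.x β))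

omit h in
theorem expAdLinear_apply (C : ChevalleyBasisD4 F L) (β : RootD4) (t : F) (v : L) :
    C.expAdLinear β t v = C.expAd β t v := rfl

omit h in
theorem symm_single (C : ChevalleyBasisD4 F L) (s : RootD4 → ℤˣ) (n : Outer → Fin 2) :
    ((C.toTensor s).symm (Pi.single n 1) : L) = C.y s (root n) := by
  rw [← C.toTensor_g₁Basis s, LinearEquiv.symm_apply_apply, coe_g₁Basis]

theorem IsNormalizing.tensorMap_upper (i : Outer) (t : F) (v : C.g₁) :
    ((C.toTensor s).symm (tensorMap (Pi.mulSingle i !![1, t; 0, 1]) (C.toTensor s v)) : L) =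
      C.expAd (RootD4.simple i) t v := by
  have : C.g₁.subtype ∘ₗ (C.toTensor s).symm.toLinearMap ∘ₗ
      tensorMap (Pi.mulSingle i !![1, t; 0, 1]) ∘ₗ (C.toTensor s).toLinearMap =
      C.expAdLinear (RootD4.simple i) t ∘ₗ C.g₁.subtype := by
    refine (C.g₁Basis s).ext fun n => ?_
    simp only [LinearMap.comp_apply, LinearEquiv.coe_coe, toTensor_g₁Basis, Submodule.subtype_apply,
      tensorMap_mulSingle_single, Fin.sum_univ_two, map_add, map_smul, symm_single, coe_g₁Basis,
      expAdLinear_apply, expAd, h.lie_simple_root]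
    have hu := Function.update_eq_self i n
    have hz : ⁅C.x (RootD4.simple i), C.y s (root (Function.update n i 0))⁆ = 0 := by
      rw [h.lie_simple_root, if_neg (by simp)]
    rcases (by decide : ∀ a : Fin 2, a = 0 ∨ a = 1) (n i) with hn | hn <;> rw [hn] at hu <;>
      simp [hn, hu, hz, add_comm]
  exact LinearMap.congr_fun this v

theorem IsNormalizing.tensorMap_lower (i : Outer) (t : F) (v : C.g₁) :
    ((C.toTensor s).symm (tensorMap (Pi.mulSingle i !![1, 0; t, 1]) (C.toTensor s v)) : L) =
      C.expAd (RootD4.simple i).opp t v := by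
  have : C.g₁.subtype ∘ₗ (C.toTensor s).symm.toLinearMap ∘ₗ
      tensorMap (Pi.mulSingle i !![1, 0; t, 1]) ∘ₗ (C.toTensor s).toLinearMap =
      C.expAdLinear (RootD4.simple i).opp t ∘ₗ C.g₁.subtype := by
    refine (C.g₁Basis s).ext fun n => ?_
    simp only [LinearMap.comp_apply, LinearEquiv.coe_coe, toTensor_g₁Basis, Submodule.subtype_apply,
      tensorMap_mulSingle_single, Fin.sum_univ_two, map_add, map_smul, symm_single, coe_g₁Basis,
      expAdLinear_apply, expAd, h.lie_simple_opp_root]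
    have hu := Function.update_eq_self i n
    have hz : ⁅C.x (RootD4.simple i).opp, C.y s (root (Function.update n i 1))⁆ = 0 := by
      rw [h.lie_simple_opp_root, if_neg (by simp)]
    rcases (by decide : ∀ a : Fin 2, a = 0 ∨ a = 1) (n i) with hn | hn <;> rw [hn] at hu <;>
      simp [hn, hu, hz]
  exact LinearMap.congr_fun this v

end

end ChevalleyBasisD4

/-! ### Diagram automorphisms -/

namespace ChevalleyBasisD4

open RootD4

/-- The permutation of the simple roots that extends `σ` and fixes the central node. -/
def nodePerm (σ : Equiv.Perm Outer) : Equiv.Perm (Fin 4) := Equiv.Perm.ofSubtype σ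

theorem nodePerm_coe (σ : Equiv.Perm Outer) (i : Outer) : nodePerm σ i = σ i :=
  Equiv.Perm.ofSubtype_apply_coe σ i

theorem nodePerm_one (σ : Equiv.Perm Outer) : nodePerm σ 1 = 1 :=
  Equiv.Perm.ofSubtype_apply_of_not_mem σ (by simp)

theorem nodePerm_symm_one (σ : Equiv.Perm Outer) : (nodePerm σ).symm 1 = 1 := by
  rw [Equiv.symm_apply_eq, nodePerm_one]

/-- The action of a diagram automorphism on the roots. -/
def rootPerm (σ : Equiv.Perm Outer) (β : RootD4) : RootD4 :=
  ⟨β.coeff ∘ (nodePerm σ).symm, by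
    have h1 : ∀ a : Fin 4 → ℤ, a ⬝ᵥ (CartanMatrix.D 4).mulVec a =
        2 * ∑ i, a i * a i + 2 * (a 1 * a 1) - a 1 * ∑ i, a i - a 1 * ∑ i, a i := fun a => by
      simp only [dotProduct, Matrix.mulVec, CartanMatrix.D_four, Fin.sum_univ_four]
      simp
      ring
    have h3 := β.pairing_self
    rw [pairing_eq] at h3
    rw [h1]
    refine Eq.trans ?_ h3
    simp only [Function.comp_apply, nodePerm_symm_one]
    rw [Equiv.sum_comp (nodePerm σ).symm β.coeff,
      Equiv.sum_comp (nodePerm σ).symm fun i => β.coeff i * β.coeff i]⟩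

theorem coeff_rootPerm (σ : Equiv.Perm Outer) (β : RootD4) :
    (rootPerm σ β).coeff = β.coeff ∘ (nodePerm σ).symm := rfl

theorem pairing_rootPerm (σ : Equiv.Perm Outer) (β γ : RootD4) :
    (rootPerm σ β).pairing (rootPerm σ γ) = β.pairing γ := by
  simp only [pairing_eq, coeff_rootPerm, Function.comp_apply, nodePerm_symm_one]
  rw [Equiv.sum_comp (nodePerm σ).symm β.coeff, Equiv.sum_comp (nodePerm σ).symm γ.coeff,
    Equiv.sum_comp (nodePerm σ).symm fun i => β.coeff i * γ.coeff i]

theorem eps_rootPerm (σ : Equiv.Perm Outer) (β γ : RootD4) :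
    eps (rootPerm σ β).coeff (rootPerm σ γ).coeff = eps β.coeff γ.coeff := by
  simp only [eps, form, coeff_rootPerm, Function.comp_apply, nodePerm_symm_one]
  rw [Equiv.sum_comp (nodePerm σ).symm γ.coeff,
    Equiv.sum_comp (nodePerm σ).symm fun i => β.coeff i * γ.coeff i]

theorem rootPerm_bijective (σ : Equiv.Perm Outer) : Function.Bijective (rootPerm σ) := by
  refine Finite.injective_iff_bijective.1 fun β γ h => coeff_injective ?_
  have := congrArg coeff h
  rw [coeff_rootPerm, coeff_rootPerm] at this
  exact (nodePerm σ).symm.surjective.injective_comp_right this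

theorem rootPerm_opp (σ : Equiv.Perm Outer) (β : RootD4) :
    rootPerm σ β.opp = (rootPerm σ β).opp := rfl

theorem rootPerm_simple (σ : Equiv.Perm Outer) (i : Fin 4) :
    rootPerm σ (RootD4.simple i) = RootD4.simple (nodePerm σ i) := by
  apply coeff_injective
  rw [coeff_rootPerm, coeff_simple, coeff_simple]
  ext j
  simp only [Function.comp_apply, Pi.single_apply, Equiv.symm_apply_eq]

theorem rootPerm_root (σ : Equiv.Perm Outer) (n : Outer → Fin 2) :
    rootPerm σ (root n) = root (n ∘ σ.symm) := by
  have hr : ∀ (m : Outer → Fin 2) (i : Outer), (root m).coeff i = 1 - (m i : ℤ) := by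
    decide +kernel
  have hr1 : ∀ m : Outer → Fin 2, (root m).coeff 1 = 1 := fun _ => rfl
  apply coeff_injective
  ext j
  rw [coeff_rootPerm, Function.comp_apply]
  by_cases hj : j = 1
  · rw [hj, nodePerm_symm_one, hr1, hr1]
  · have : (nodePerm σ).symm j = (σ.symm ⟨j, hj⟩ : Outer) := by
      rw [Equiv.symm_apply_eq, nodePerm_coe, Equiv.apply_symm_apply]
    rw [this, hr, hr _ ⟨j, hj⟩, Function.comp_apply]

section

variable {F L : Type*} [Field F] [LieRing L] [LieAlgebra F L] {C : ChevalleyBasisD4 F L}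
  {s : RootD4 → ℤˣ}

/-- The linear map that permutes the rescaled root vectors and the `hᵢ` by `σ`. It preserves the
bracket since the signs `eps` are invariant under the diagram automorphisms. -/
noncomputable def diagramLinear (C : ChevalleyBasisD4 F L) (s : RootD4 → ℤˣ)
    (σ : Equiv.Perm Outer) : L ≃ₗ[F] L :=
  (C.signedBasis s).equiv (C.signedBasis s)
    (Equiv.sumCongr (nodePerm σ) (Equiv.ofBijective _ (rootPerm_bijective σ)))

theorem diagramLinear_h (σ : Equiv.Perm Outer) (i : Fin 4) :
    C.diagramLinear s σ (C.basis (Sum.inl i)) = C.basis (Sum.inl (nodePerm σ i)) := by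
  rw [← C.signedBasis_inl s, diagramLinear, Module.Basis.equiv_apply, ← C.signedBasis_inl s]
  rfl

theorem diagramLinear_y (σ : Equiv.Perm Outer) (β : RootD4) :
    C.diagramLinear s σ (C.y s β) = C.y s (rootPerm σ β) := by
  rw [y, diagramLinear, Module.Basis.equiv_apply]
  rfl

theorem IsNormalizing.diagramLinear_lie (h : IsNormalizing C s) (σ : Equiv.Perm Outer) (v w : L) :
    C.diagramLinear s σ ⁅v, w⁆ = ⁅C.diagramLinear s σ v, C.diagramLinear s σ w⁆ := by
  have hxy : ∀ i β, C.diagramLinear s σ ⁅C.basis (Sum.inl i), C.y s β⁆ =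
      ⁅C.diagramLinear s σ (C.basis (Sum.inl i)), C.diagramLinear s σ (C.y s β)⁆ := fun i β => by
    rw [lie_h_y, map_smul, diagramLinear_h, diagramLinear_y, lie_h_y, ← rootPerm_simple,
      pairing_rootPerm]
  have key : ∀ j k, C.diagramLinear s σ ⁅C.signedBasis s j, C.signedBasis s k⁆ =
      ⁅C.diagramLinear s σ (C.signedBasis s j), C.diagramLinear s σ (C.signedBasis s k)⁆ := by
    rintro (i | β) (j | γ)
    · rw [signedBasis_inl, signedBasis_inl, C.lie_h_h, diagramLinear_h, diagramLinear_h, C.lie_h_h,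
        map_zero]
    · rw [signedBasis_inl]
      exact hxy i γ
    · rw [signedBasis_inl, ← lie_skew, ← lie_skew (C.diagramLinear s σ _), map_neg]
      exact congrArg Neg.neg (hxy j β)
    · change C.diagramLinear s σ ⁅C.y s β, C.y s γ⁆ =
        ⁅C.diagramLinear s σ (C.y s β), C.diagramLinear s σ (C.y s γ)⁆
      rw [diagramLinear_y, diagramLinear_y]
      by_cases h1 : ∃ δ : RootD4, β.coeff + γ.coeff = δ.coeff
      · obtain ⟨δ, hδ⟩ := h1
        have hδ' : (rootPerm σ β).coeff + (rootPerm σ γ).coeff = (rootPerm σ δ).coeff := by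
          rw [coeff_rootPerm, coeff_rootPerm, coeff_rootPerm, ← hδ]; rfl
        rw [h.lie_y_add hδ, h.lie_y_add hδ', eps_rootPerm, map_smul, diagramLinear_y]
      · by_cases h0 : γ = β.opp
        · subst h0
          rw [rootPerm_opp, h.lie_y_opp, h.lie_y_opp, map_neg, map_sum,
            ← Equiv.sum_comp (nodePerm σ) fun i => _ • C.basis (Sum.inl i)]
          simp only [map_smul, diagramLinear_h, coeff_rootPerm, Function.comp_apply,
            Equiv.symm_apply_apply]
        -- `β + γ` is neither zero nor a root
        · have hp : 0 ≤ β.pairing γ := by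
            revert β γ; decide +kernel
          rw [lie_y_of_pairing_nonneg hp, map_zero,
            lie_y_of_pairing_nonneg (by rw [pairing_rootPerm]; exact hp)]
  have hspan : ∀ u : L, u ∈ Submodule.span F (Set.range (C.signedBasis s)) := fun u => by
    rw [(C.signedBasis s).span_eq]; trivial
  induction hspan v using Submodule.span_induction with
  | mem v hv =>
    induction hspan w using Submodule.span_induction with
    | mem w hw =>
      obtain ⟨j, rfl⟩ := hv
      obtain ⟨k, rfl⟩ := hw
      exact key j k
    | zero => simp
    | add a b _ _ ha hb => rw [lie_add, map_add, ha, hb, map_add, lie_add]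
    | smul t a _ ha => rw [lie_smul, map_smul, ha, map_smul, lie_smul]
  | zero => simp
  | add a b _ _ ha hb => rw [add_lie, map_add, ha, hb, map_add, add_lie]
  | smul t a _ ha => rw [smul_lie, map_smul, ha, map_smul, smul_lie]

/-- The diagram automorphism of the Lie algebra. -/
noncomputable def IsNormalizing.diagramAut (h : IsNormalizing C s) (σ : Equiv.Perm Outer) :
    L ≃ₗ⁅F⁆ L :=
  { C.diagramLinear s σ with map_lie' := fun {v w} => h.diagramLinear_lie σ v w }

theorem IsNormalizing.isDiagramAut (h : IsNormalizing C s) (σ : Equiv.Perm Outer) :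
    C.IsDiagramAut σ (h.diagramAut σ) := by
  have h1 : ∀ i, h.diagramAut σ (C.x (RootD4.simple i)) = C.x (RootD4.simple (nodePerm σ i)) :=
    fun i => by
      rw [h.x_simple, h.x_simple, ← rootPerm_simple]
      exact diagramLinear_y σ _
  have h2 : ∀ i, h.diagramAut σ (C.x (RootD4.simple i).opp) =
      C.x (RootD4.simple (nodePerm σ i)).opp := fun i => by
    rw [h.x_simple_opp, h.x_simple_opp, ← rootPerm_simple, ← rootPerm_opp, map_neg]
    exact congrArg Neg.neg (diagramLinear_y σ _)
  refine ⟨fun i => ⟨?_, ?_⟩, ?_, ?_⟩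
  · rw [h1, nodePerm_coe]
  · rw [h2, nodePerm_coe]
  · rw [h1, nodePerm_one]
  · rw [h2, nodePerm_one]

/-- Under the identification of `𝔤₁` with `k² ⊗ k² ⊗ k²`, the diagram automorphisms permute the
factors. -/
theorem IsNormalizing.permMap_eq (h : IsNormalizing C s) (σ : Equiv.Perm Outer) (v : C.g₁) :
    ((C.toTensor s).symm (permMap F σ (C.toTensor s v)) : L) = h.diagramAut σ v := by
  have : C.g₁.subtype ∘ₗ (C.toTensor s).symm.toLinearMap ∘ₗ permMap F σ ∘ₗ
      (C.toTensor s).toLinearMap = (C.diagramLinear s σ).toLinearMap ∘ₗ C.g₁.subtype := by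
    refine (C.g₁Basis s).ext fun n => ?_
    simp only [LinearMap.comp_apply, LinearEquiv.coe_coe, toTensor_g₁Basis, Submodule.subtype_apply,
      permMap_single, symm_single, coe_g₁Basis, diagramLinear_y, rootPerm_root]
  exact LinearMap.congr_fun this v

/-! ### The bilinear form -/

theorem coord_rho_y (t : F) :
    C.basis.coord (Sum.inr rho) (t • C.y s rho) = (s rho : ℤ) * t := by
  rw [y_eq, x, map_smul, map_smul]
  simp [mul_comm]

/-- The complementary index, with all entries changed; the roots `root n` and `root (compl n)`
have sum `ρ`. -/
def compl (n : Outer → Fin 2) : Outer → Fin 2 := fun i => n i + 1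

/-- The sign `⟨e_n, e_{compl n}⟩` of a basis tensor. -/
def sgn (n : Outer → Fin 2) : ℤ := ∏ i, if n i = 0 then 1 else -1

theorem symp_eq_sum (v w : (Outer → Fin 2) → F) :
    symp v w = ∑ n, (sgn n : F) * (v n * w (compl n)) := by
  have hc : ∀ a b c, compl (idx a b c) = idx (a + 1) (b + 1) (c + 1) := by decide
  have h2 : (1 + 1 : Fin 2) = 0 := rfl
  simp only [sum_idx, Fin.sum_univ_two, hc, sgn, prod_outer, idx_o₀, idx_o₂, idx_o₃, symp, h2]
  norm_num
  ring

theorem IsNormalizing.lie_root_root (h : IsNormalizing C s) (n m : Outer → Fin 2) :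
    ⁅C.y s (root n), C.y s (root m)⁆ = if m = compl n then (-sgn n : F) • C.y s rho else 0 := by
  split_ifs with hm
  · subst hm
    have h1 : (root n).coeff + (root (compl n)).coeff = rho.coeff := by
      revert n; decide +kernel
    have h2 : (eps (root n).coeff (root (compl n)).coeff : ℤ) = -sgn n := by
      revert n; decide +kernel
    rw [h.lie_y_add h1, h2]
    push_cast
    rfl
  · exact lie_y_of_pairing_nonneg (by revert n m; decide +kernel)

theorem IsNormalizing.lie_sum_root (h : IsNormalizing C s) (v w : (Outer → Fin 2) → F) :
    ⁅∑ n, v n • C.y s (root n), ∑ n, w n • C.y s (root n)⁆ = (-symp v w) • C.y s rho := by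
  rw [sum_lie_sum, symp_eq_sum, ← Finset.sum_neg_distrib, Finset.sum_smul]
  refine Finset.sum_congr rfl fun n _ => ?_
  simp only [smul_lie, lie_smul, h.lie_root_root, smul_ite, smul_zero]
  rw [Finset.sum_ite_eq' Finset.univ (compl n), if_pos (Finset.mem_univ _), smul_smul, smul_smul]
  congr 1
  ring

/-- The bilinear form of `𝔤₁` is, up to a sign, the tensor product of the three symplectic forms. -/
theorem IsNormalizing.bilin_eq (h : IsNormalizing C s) (v w : C.g₁) :
    C.bilin v w = -(s rho : ℤ) * symp (C.toTensor s v) (C.toTensor s w) := by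
  rw [bilin, C.coe_eq_sum s v, C.coe_eq_sum s w, h.lie_sum_root, coord_rho_y]
  ring

end

end ChevalleyBasisD4

/-! ### The quartic form -/

namespace ChevalleyBasisD4

open RootD4

theorem pairing_root (n m : Outer → Fin 2) :
    (root n).pairing (root m) = 2 - ∑ i, if n i = m i then 0 else 1 := by
  revert n m; decide +kernel

section

variable {F L : Type*} [Field F] [LieRing L] [LieAlgebra F L] {C : ChevalleyBasisD4 F L}
  {s : RootD4 → ℤˣ}

theorem IsNormalizing.lie_root_rho_opp (h : IsNormalizing C s) (n : Outer → Fin 2) :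
    ⁅C.y s (root n), C.y s rho.opp⁆ = (sgn n : F) • C.y s (root (compl n)).opp := by
  have h1 : (root n).coeff + rho.opp.coeff = (root (compl n)).opp.coeff := by
    revert n; decide +kernel
  have h2 : (eps (root n).coeff rho.opp.coeff : ℤ) = sgn n := by revert n; decide +kernel
  rw [h.lie_y_add h1, h2]

/-- The root `± αᵢ` by which two adjacent roots of height one differ. -/
def stepRoot (n : Outer → Fin 2) (i : Outer) : RootD4 :=
  if n i = 1 then RootD4.simple i else (RootD4.simple i).opp

/-- The sign in the bracket of `y_{root (flip n i)}` and `y_{-root n}`. -/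
def stepSign (n : Outer → Fin 2) (i : Outer) : ℤ :=
  eps (root (flip n i)).coeff (root n).coeff

theorem IsNormalizing.lie_flip_root_opp (h : IsNormalizing C s) (n : Outer → Fin 2) (i : Outer) :
    ⁅C.y s (root (flip n i)), C.y s (root n).opp⁆ =
      (stepSign n i : F) • C.y s (stepRoot n i) := by
  have h1 : (root (flip n i)).coeff + (root n).opp.coeff = (stepRoot n i).coeff := by
    revert n i; decide +kernel
  rw [h.lie_y_add h1, coeff_opp, eps_neg_right, stepSign]

/-- The components of `[v, y_{-root n}]` in degree zero: root vectors of the `±αᵢ`, and a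
multiple of the coroot of `root n`. -/
theorem IsNormalizing.lie_sum_root_opp (h : IsNormalizing C s) (w : (Outer → Fin 2) → F)
    (n : Outer → Fin 2) : ⁅∑ m, w m • C.y s (root m), C.y s (root n).opp⁆ =
      ∑ i, (w (flip n i) * stepSign n i) • C.y s (stepRoot n i)
        - w n • ∑ i, ((root n).coeff i : F) • C.basis (Sum.inl i) := by
  have hn : n ∉ Finset.univ.image (flip n) := by revert n; decide
  have hz : ∀ m ∉ insert n (Finset.univ.image (flip n)), 0 ≤ (root m).pairing (root n).opp := by
    revert n; decide +kernel
  rw [sum_lie, ← Finset.sum_subset (Finset.subset_univ (insert n (Finset.univ.image (flip n)))),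
    Finset.sum_insert hn, Finset.sum_image ((flip_injective n).injOn), add_comm, sub_eq_add_neg]
  · congr 1
    · refine Finset.sum_congr rfl fun i _ => ?_
      rw [smul_lie, h.lie_flip_root_opp, smul_smul]
    · rw [smul_lie, h.lie_y_opp, smul_neg]
  · intro m _ hm
    rw [smul_lie, lie_y_of_pairing_nonneg (hz m hm), smul_zero]

theorem IsNormalizing.lie_stepRoot (h : IsNormalizing C s) (n m : Outer → Fin 2) (i : Outer) :
    ⁅C.y s (stepRoot n i), C.y s (root m)⁆ =
      if m i = n i then ((2 * (n i : ℤ) - 1 : ℤ) : F) • C.y s (root (flip m i)) else 0 := by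
  have hfin : ∀ a : Fin 2, a = 0 ∨ a = 1 := by decide
  rcases hfin (n i) with hn | hn
  · have : C.y s (stepRoot n i) = -C.x (RootD4.simple i).opp := by
      rw [h.x_simple_opp, neg_neg, stepRoot, if_neg (by simp [hn])]
    rw [this, neg_lie, h.lie_simple_opp_root, hn]
    split_ifs with hm
    · simp [flip, hm]
    · simp
  · rw [stepRoot, if_pos hn, ← h.x_simple, h.lie_simple_root, hn]
    split_ifs with hm
    · have : ((2 * ((1 : Fin 2) : ℤ) - 1 : ℤ) : F) = 1 := by norm_num
      rw [this, one_smul, flip, hm]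
      rfl
    · rfl

/-- The tensor of `[y_{±αᵢ}, v]`, for the tensor `w` of `v` and the root `±αᵢ = stepRoot n i`. -/
def stepMap (w : (Outer → Fin 2) → F) (n : Outer → Fin 2) (i : Outer) : (Outer → Fin 2) → F :=
  fun m => if m i = n i then 0 else ((2 * (n i : ℤ) - 1 : ℤ) : F) * w (flip m i)

theorem IsNormalizing.lie_stepRoot_sum (h : IsNormalizing C s) (w : (Outer → Fin 2) → F)
    (n : Outer → Fin 2) (i : Outer) :
    ⁅C.y s (stepRoot n i), ∑ m, w m • C.y s (root m)⁆ =
      ∑ m, stepMap w n i m • C.y s (root m) := by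
  have hinv : Function.Involutive fun m : Outer → Fin 2 => flip m i := by
    intro m; revert m i; decide
  have hi : ∀ m : Outer → Fin 2, flip m i i = n i ↔ m i ≠ n i := by
    clear hinv; revert n i; decide
  rw [lie_sum, ← Equiv.sum_comp hinv.toPerm]
  refine Finset.sum_congr rfl fun m _ => ?_
  have hm : flip (flip m i) i = m := hinv m
  simp only [Function.Involutive.coe_toPerm, lie_smul, h.lie_stepRoot, hi, stepMap, hm]
  by_cases h1 : m i = n i
  · simp [h1]
  · simp [h1, smul_smul, mul_comm]

theorem IsNormalizing.lie_coroot_sum (w : (Outer → Fin 2) → F) (n : Outer → Fin 2) :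
    ⁅∑ i, ((root n).coeff i : F) • C.basis (Sum.inl i), ∑ m, w m • C.y s (root m)⁆ =
      ∑ m, (((root n).pairing (root m) : F) * w m) • C.y s (root m) := by
  rw [lie_sum]
  exact Finset.sum_congr rfl fun m _ => by rw [lie_smul, lie_coroot_y, smul_smul, mul_comm]

/-- The coefficient of `y_ρ` in `(ad v)⁴ y_{-ρ}`, as a sum over the components of
`[v, y_{-ρ}]`. -/
theorem IsNormalizing.ad_pow_four (h : IsNormalizing C s) (w : (Outer → Fin 2) → F) :
    (LieAlgebra.ad F L (∑ m, w m • C.y s (root m)) ^ 4) (C.y s rho.opp) =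
      (∑ n, (sgn n * w n) * (∑ i, w (flip (compl n) i) * stepSign (compl n) i *
          symp w (stepMap w (compl n) i) -
        w (compl n) * symp w (fun m => (root (compl n)).pairing (root m) * w m))) •
        C.y s rho := by
  set v := ∑ m, w m • C.y s (root m) with hv
  have e : (LieAlgebra.ad F L v ^ 4) (C.y s rho.opp) = ⁅v, ⁅v, ⁅v, ⁅v, C.y s rho.opp⁆⁆⁆⁆ := by
    simp only [pow_succ, pow_zero, one_mul, Module.End.mul_apply, LieAlgebra.ad_apply]
  have h1 : ⁅v, C.y s rho.opp⁆ = ∑ n, (sgn n * w n : F) • C.y s (root (compl n)).opp := by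
    rw [hv, sum_lie]
    exact Finset.sum_congr rfl fun n _ => by
      rw [smul_lie, h.lie_root_rho_opp, smul_smul, mul_comm]
  have h3 : ∀ n i, ⁅v, ⁅v, C.y s (stepRoot n i)⁆⁆ = symp w (stepMap w n i) • C.y s rho :=
    fun n i => by
      rw [← lie_skew v (C.y s _), lie_neg, hv, h.lie_stepRoot_sum, h.lie_sum_root, neg_smul,
        neg_neg]
  have h4 : ∀ n, ⁅v, ⁅v, ∑ i, ((root n).coeff i : F) • C.basis (Sum.inl i)⁆⁆ =
      symp w (fun m => (root n).pairing (root m) * w m) • C.y s rho := fun n => by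
    rw [← lie_skew v (∑ i, _), lie_neg, hv, lie_coroot_sum, h.lie_sum_root, neg_smul, neg_neg]
  rw [e, h1]
  simp only [lie_sum, lie_smul, Finset.sum_smul]
  refine Finset.sum_congr rfl fun n _ => ?_
  rw [hv, h.lie_sum_root_opp, ← hv, mul_smul _ (_ - _)]
  congr 1
  rw [lie_sub, lie_sub, lie_sum, lie_sum, lie_smul, lie_smul, h4, sub_smul, Finset.sum_smul,
    mul_smul]
  congr 1
  refine Finset.sum_congr rfl fun i _ => ?_
  rw [lie_smul, lie_smul, h3, smul_smul]

theorem sum_eq_hyperdet (w : (Outer → Fin 2) → F) :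
    ∑ n, (sgn n * w n) * (∑ i, w (flip (compl n) i) * stepSign (compl n) i *
          symp w (stepMap w (compl n) i) -
        w (compl n) * symp w (fun m => (root (compl n)).pairing (root m) * w m)) =
      -6 * hyperdet w := by
  have hc : ∀ a b c, compl (idx a b c) = idx (a + 1) (b + 1) (c + 1) := by decide
  have h2 : (1 + 1 : Fin 2) = 0 := rfl
  have hstep : ∀ n i, stepSign n i = if n i = 0 then 1 else -1 := by decide +kernel
  simp only [sum_idx, Fin.sum_univ_two, sum_outer, hc, sgn, prod_outer, hstep, pairing_root, symp,
    stepMap, flip, idx_o₀, idx_o₂, idx_o₃, update_idx_o₀, update_idx_o₂, update_idx_o₃, h2,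
    hyperdet, zero_add]
  norm_num
  ring

/-- The quartic form of `𝔤₁` is six times the hyperdeterminant; the sign `s ρ` cancels, as both
`x_ρ` and `x_{-ρ}` are rescaled. -/
theorem IsNormalizing.quartic_eq (h : IsNormalizing C s) (v : C.g₁) :
    C.quartic v = 6 * hyperdet (C.toTensor s v) := by
  rw [quartic, C.x_eq s, h.opp, map_smul, C.coe_eq_sum s v, h.ad_pow_four, sum_eq_hyperdet,
    map_smul, coord_rho_y]
  push_cast
  rw [smul_eq_mul]
  linear_combination 6 * hyperdet (C.toTensor s v) * sign_mul_self (F := F) (s rho)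

end

end ChevalleyBasisD4

/-! ### The action of `SL₂³ ⋊ S₃` -/

namespace ChevalleyBasisD4

section

variable {k : Type*} [Field k]

/-- The action of `SL₂³ ⋊ S₃` on `k² ⊗ k² ⊗ k²`. -/
def tensorAction (k : Type*) [Field k] : SL2CubedS3 k →* Module.End k ((Outer → Fin 2) → k) where
  toFun g := tensorMap (fun i => (g.left i : Matrix (Fin 2) (Fin 2) k)) * permMap k g.right
  map_one' := by
    change tensorMap (1 : Outer → Matrix (Fin 2) (Fin 2) k) * permMap k 1 = 1
    rw [tensorMap_one, permMap_one, one_mul]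
  map_mul' a b := by
    have : (fun i => ((a * b).left i : Matrix (Fin 2) (Fin 2) k)) =
        (fun i => (a.left i : Matrix (Fin 2) (Fin 2) k)) *
          ((fun i => (b.left i : Matrix (Fin 2) (Fin 2) k)) ∘ a.right.symm) := by
      funext i
      rw [SemidirectProduct.mul_left]
      rfl
    rw [this, tensorMap_mul, SemidirectProduct.mul_right, permMap_mul, mul_assoc, mul_assoc,
      ← mul_assoc (permMap k a.right), permMap_mul_tensorMap, mul_assoc]

theorem tensorAction_apply (g : SL2CubedS3 k) : tensorAction k g =
    tensorMap (fun i => (g.left i : Matrix (Fin 2) (Fin 2) k)) * permMap k g.right := rfl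

theorem tensorAction_single (g : SL2CubedS3 k) (n m : Outer → Fin 2) :
    tensorAction k g (Pi.single m 1) n =
      ∏ i, (g.left i : Matrix (Fin 2) (Fin 2) k) (n i) (m (g.right.symm i)) := by
  rw [tensorAction_apply, Module.End.mul_apply, permMap_single, tensorMap_single]
  rfl

theorem hyperdet_tensorAction (g : SL2CubedS3 k) (v : (Outer → Fin 2) → k) :
    hyperdet (tensorAction k g v) = hyperdet v := by
  rw [tensorAction_apply, Module.End.mul_apply, hyperdet_tensorMap, hyperdet_permMap]
  simp

theorem symp_tensorAction (g : SL2CubedS3 k) (v w : (Outer → Fin 2) → k) :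
    symp (tensorAction k g v) (tensorAction k g w) = symp v w := by
  rw [tensorAction_apply, Module.End.mul_apply, Module.End.mul_apply, symp_tensorMap, symp_permMap]
  simp

/-- The kernel of the action, read off from the entries of the matrix of `⨂ A i` in the basis of
pure tensors. -/
theorem tensorAction_eq_one_iff (g : SL2CubedS3 k) : tensorAction k g = 1 ↔
    g.right = 1 ∧ ∃ ε : Outer → ℤˣ, ∏ i, ε i = 1 ∧
      ∀ i, (g.left i : Matrix (Fin 2) (Fin 2) k) = ((ε i : ℤ) : k) • 1 := by
  constructor
  · intro h
    have key : ∀ n m : Outer → Fin 2,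
        ∏ i, (g.left i : Matrix (Fin 2) (Fin 2) k) (n i) (m (g.right.symm i)) =
          if n = m then 1 else 0 := fun n m => by
      rw [← tensorAction_single, h, Module.End.one_apply, Pi.single_apply]
    have hr : g.right = 1 := by
      by_contra hσ
      have hσ' : g.right.symm ≠ 1 := fun e => hσ (by
        rw [← inv_eq_one]; exact e)
      obtain ⟨o, ho⟩ : ∃ o, g.right.symm o ≠ o := by
        by_contra! hc
        exact hσ' (Equiv.ext hc)
      have hne : ∀ (n : Outer → Fin 2) i,
          (g.left i : Matrix (Fin 2) (Fin 2) k) (n i) (n (g.right.symm i)) ≠ 0 := fun n i h0 => by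
        have := key n n
        rw [if_pos rfl, Finset.prod_eq_zero (Finset.mem_univ i) h0] at this
        exact zero_ne_one this
      -- the factor at `o` has no zero entry, which produces a nonzero entry off the diagonal
      let m : Outer → Fin 2 := Pi.single (g.right.symm o) 1
      have hm := key 0 m
      rw [if_neg fun e => by simpa [m] using congrFun e (g.right.symm o)] at hm
      obtain ⟨i, -, hi⟩ := Finset.prod_eq_zero_iff.1 hm
      by_cases hio : i = o
      · subst hio
        refine hne m i ?_
        simpa [m, Pi.single_eq_of_ne' ho] using hi
      · refine hne 0 i ?_
        have : g.right.symm i ≠ g.right.symm o := fun e => hio (g.right.symm.injective e)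
        simpa [m, Pi.single_eq_of_ne this] using hi
    refine ⟨hr, ?_⟩
    rw [hr] at key
    replace key : ∀ n m : Outer → Fin 2,
      ∏ i, (g.left i : Matrix (Fin 2) (Fin 2) k) (n i) (m i) = if n = m then 1 else 0 := key
    have hdiag : ∀ i a, (g.left i : Matrix (Fin 2) (Fin 2) k) a a ≠ 0 := fun i a h0 => by
      have := key (fun _ => a) (fun _ => a)
      rw [if_pos rfl, Finset.prod_eq_zero (Finset.mem_univ i) h0] at this
      exact zero_ne_one this
    -- changing the `i`-th index off the diagonal leaves the other factors nonzero
    have hoff : ∀ i a b, a ≠ b → (g.left i : Matrix (Fin 2) (Fin 2) k) a b = 0 := by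
      intro i a b hab
      have := key (fun _ => a) (Function.update (fun _ => a) i b)
      rw [if_neg fun e => hab (by simpa using congrFun e i)] at this
      obtain ⟨j, -, hj⟩ := Finset.prod_eq_zero_iff.1 this
      by_cases hji : j = i
      · subst hji; simpa using hj
      · rw [Function.update_of_ne hji] at hj
        exact absurd hj (hdiag j a)
    have hentry : ∀ i, (g.left i : Matrix (Fin 2) (Fin 2) k) 0 0 =
        (g.left i : Matrix (Fin 2) (Fin 2) k) 1 1 := fun i => by
      have h1 := key (fun _ => 0) (fun _ => 0)
      let m : Outer → Fin 2 := Function.update (fun _ => 0) i 1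
      have h2 := key m m
      rw [if_pos rfl, ← Finset.mul_prod_erase _ _ (Finset.mem_univ i)] at h1 h2
      have e : ∏ j ∈ Finset.univ.erase i, (g.left j : Matrix (Fin 2) (Fin 2) k)
          (m j) (m j) =
          ∏ j ∈ Finset.univ.erase i, (g.left j : Matrix (Fin 2) (Fin 2) k) 0 0 :=
        Finset.prod_congr rfl fun j hj => by
          rw [show m j = 0 from Function.update_of_ne (Finset.ne_of_mem_erase hj) _ _]
      rw [e, show m i = 1 from Function.update_self ..] at h2
      refine mul_right_cancel₀ (fun h0 => ?_) (h1.trans h2.symm)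
      rw [h0, mul_zero] at h1
      exact zero_ne_one h1
    have hsq : ∀ i, (g.left i : Matrix (Fin 2) (Fin 2) k) 0 0 = 1 ∨
        (g.left i : Matrix (Fin 2) (Fin 2) k) 0 0 = -1 := fun i => by
      have hd := (g.left i).det_coe
      rw [Matrix.det_fin_two, hoff i 0 1 (by decide), zero_mul, sub_zero, ← hentry] at hd
      exact mul_self_eq_one_iff.1 hd
    have hε : ∃ ε : Outer → ℤˣ, (∏ i, ε i = 1) ∧
        ∀ i, (g.left i : Matrix (Fin 2) (Fin 2) k) 0 0 = ((ε i : ℤ) : k) := by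
      -- in characteristic `2` the signs are not determined by their images in `k`
      by_cases h2 : (1 : k) = -1
      · refine ⟨1, by simp, fun i => ?_⟩
        rcases hsq i with e | e <;> rw [e] <;> simp [← h2]
      · have : ∀ i, ∃ ε : ℤˣ, (g.left i : Matrix (Fin 2) (Fin 2) k) 0 0 = ((ε : ℤ) : k) :=
          fun i => (hsq i).elim (fun e => ⟨1, by simp [e]⟩) fun e => ⟨-1, by simp [e]⟩
        choose ε hε using this
        refine ⟨ε, ?_, hε⟩
        have h1 := key (fun _ => 0) (fun _ => 0)
        simp only [hε, if_true] at h1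
        have h3 : (((∏ i, ε i : ℤˣ) : ℤ) : k) = 1 := by rw [← h1]; push_cast; rfl
        rcases Int.units_eq_one_or (∏ i, ε i) with e | e
        · exact e
        · rw [e] at h3
          exact absurd (by simpa using h3.symm) h2
    obtain ⟨ε, hprod, hε⟩ := hε
    refine ⟨ε, hprod, fun i => ?_⟩
    ext a b
    rw [Matrix.smul_apply, Matrix.one_apply, ← hε]
    split_ifs with hab
    · subst hab
      rcases (by decide : ∀ a : Fin 2, a = 0 ∨ a = 1) a with rfl | rfl
      · simp
      · simp [hentry]
    · rw [hoff i a b hab, smul_zero]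
  · rintro ⟨hr, ε, hprod, hε⟩
    rw [tensorAction_apply, hr, permMap_one, mul_one,
      show (fun i => (g.left i : Matrix (Fin 2) (Fin 2) k)) =
        fun i => ((ε i : ℤ) : k) • (1 : Outer → Matrix (Fin 2) (Fin 2) k) i from funext hε,
      tensorMap_smul, tensorMap_one]
    have : ∏ i, ((ε i : ℤ) : k) = 1 := by
      have := congrArg (fun u : ℤˣ => ((u : ℤ) : k)) hprod
      simpa using this
    rw [this, one_smul]

/-- Over an algebraically closed field, every `⨂ A i` with `∏ det (A i) = 1`, composed with a
permutation of the factors, lies in the image of `SL₂³ ⋊ S₃`. -/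
theorem exists_tensorAction_eq [IsAlgClosed k] (A : Outer → Matrix (Fin 2) (Fin 2) k)
    (hA : ∏ i, (A i).det = 1) (σ : Equiv.Perm Outer) :
    ∃ g, tensorAction k g = tensorMap A * permMap k σ := by
  obtain ⟨t, ht⟩ := exists_tensorMap_eq_specialLinear A hA
  exact ⟨⟨t, σ⟩, by rw [tensorAction_apply, ← ht]⟩

end

section

variable {F L : Type*} [Field F] [LieRing L] [LieAlgebra F L] {C : ChevalleyBasisD4 F L}
  {s : RootD4 → ℤˣ}

/-- The action of `SL₂³ ⋊ S₃` on `𝔤₁`, transported from `k² ⊗ k² ⊗ k²`. -/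
noncomputable def naturalAction (C : ChevalleyBasisD4 F L) (s : RootD4 → ℤˣ) :
    SL2CubedS3 F →* (C.g₁ ≃ₗ[F] C.g₁) :=
  (LinearMap.GeneralLinearGroup.generalLinearEquiv F C.g₁).toMonoidHom.comp
    (MonoidHom.toHomUnits
      (((C.toTensor s).symm.conjRingEquiv : _ →* Module.End F C.g₁).comp (tensorAction F)))

theorem naturalAction_apply (g : SL2CubedS3 F) (v : C.g₁) : C.naturalAction s g v =
    (C.toTensor s).symm (tensorAction F g (C.toTensor s v)) := rfl

theorem toTensor_naturalAction (g : SL2CubedS3 F) (v : C.g₁) :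
    C.toTensor s (C.naturalAction s g v) = tensorAction F g (C.toTensor s v) := by
  rw [naturalAction_apply, LinearEquiv.apply_symm_apply]

theorem tensorAction_inl_mulSingle (i : Outer) (M : Matrix.SpecialLinearGroup (Fin 2) F) :
    tensorAction F (SemidirectProduct.inl (Pi.mulSingle i M)) =
      tensorMap (Pi.mulSingle i (M : Matrix (Fin 2) (Fin 2) F)) := by
  rw [tensorAction_apply, SemidirectProduct.right_inl, permMap_one, mul_one,
    SemidirectProduct.left_inl]
  congr 1
  funext j
  by_cases hj : j = i
  · subst hj; simp
  · simp [Pi.mulSingle_eq_of_ne hj]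

theorem tensorAction_inr (σ : Equiv.Perm Outer) :
    tensorAction F (SemidirectProduct.inr σ) = permMap F σ := by
  rw [tensorAction_apply, SemidirectProduct.left_inr, SemidirectProduct.right_inr]
  change tensorMap (1 : Outer → Matrix (Fin 2) (Fin 2) F) * _ = _
  rw [tensorMap_one, one_mul]

theorem IsNormalizing.isNaturalAction (h : IsNormalizing C s) :
    C.IsNaturalAction (C.naturalAction s) where
  map_upper i t v := by
    rw [naturalAction_apply, tensorAction_inl_mulSingle]
    exact h.tensorMap_upper i t v
  map_lower i t v := by
    rw [naturalAction_apply, tensorAction_inl_mulSingle]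
    exact h.tensorMap_lower i t v
  map_perm σ := ⟨h.diagramAut σ, h.isDiagramAut σ, fun v => by
    rw [naturalAction_apply, tensorAction_inr, h.permMap_eq]⟩

theorem naturalAction_eq_one_iff (g : SL2CubedS3 F) :
    C.naturalAction s g = 1 ↔ tensorAction F g = 1 := by
  constructor
  · intro e
    refine LinearMap.ext fun w => ?_
    obtain ⟨v, rfl⟩ := (C.toTensor s).surjective w
    rw [← toTensor_naturalAction, e]
    rfl
  · intro e
    refine LinearEquiv.ext fun v => ?_
    rw [naturalAction_apply, e, Module.End.one_apply, LinearEquiv.symm_apply_apply]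
    rfl

theorem IsNormalizing.mem_stab_iff (h : IsNormalizing C s) (h6 : (6 : F) ≠ 0)
    (g : C.g₁ ≃ₗ[F] C.g₁) : g ∈ C.stab ↔
      (∀ v, hyperdet (C.toTensor s (g v)) = hyperdet (C.toTensor s v)) ∧
      ∀ v w, symp (C.toTensor s (g v)) (C.toTensor s (g w)) =
        symp (C.toTensor s v) (C.toTensor s w) := by
  have hs : -((s RootD4.rho : ℤ) : F) ≠ 0 := by
    rcases Int.units_eq_one_or (s RootD4.rho) with e | e <;> simp [e]
  change ((∀ v, C.quartic (g v) = C.quartic v) ∧ ∀ v w, C.bilin (g v) (g w) = C.bilin v w) ↔ _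
  simp only [h.quartic_eq, h.bilin_eq]
  exact and_congr (forall_congr' fun v => mul_right_inj' h6)
    (forall_congr' fun v => forall_congr' fun w => mul_right_inj' hs)

theorem IsNormalizing.naturalAction_mem_stab (h : IsNormalizing C s) (h6 : (6 : F) ≠ 0)
    (g : SL2CubedS3 F) : C.naturalAction s g ∈ C.stab := by
  rw [h.mem_stab_iff h6]
  exact ⟨fun v => by rw [toTensor_naturalAction, hyperdet_tensorAction],
    fun v w => by rw [toTensor_naturalAction, toTensor_naturalAction, symp_tensorAction]⟩

/-- The stabilizer in `𝔤₁` over a field that need not be algebraically closed. -/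
theorem IsNormalizing.exists_of_mem_stab (h : IsNormalizing C s) (h2 : (2 : F) ≠ 0)
    (h6 : (6 : F) ≠ 0) {g : C.g₁ ≃ₗ[F] C.g₁} (hg : g ∈ C.stab) :
    ∃ (A : Outer → Matrix (Fin 2) (Fin 2) F) (σ : Equiv.Perm Outer), ∏ i, (A i).det = 1 ∧
      ∀ v, C.toTensor s (g v) = (tensorMap A * permMap F σ) (C.toTensor s v) := by
  rw [h.mem_stab_iff h6] at hg
  let T := C.toTensor s
  have hT : ∀ w, ((T.symm.trans g).trans T : _ →ₗ[F] _) w = T (g (T.symm w)) := fun _ => rfl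
  obtain ⟨A, σ, hA, e⟩ := exists_eq_tensorMap_mul_permMap h2
    (((T.symm.trans g).trans T : _ ≃ₗ[F] _) : Module.End F ((Outer → Fin 2) → F))
    ((T.symm.trans g).trans T).surjective
    (fun w => by rw [hT, hg.1, LinearEquiv.apply_symm_apply])
    (fun v w => by
      rw [hT, hT, hg.2, LinearEquiv.apply_symm_apply, LinearEquiv.apply_symm_apply])
  refine ⟨A, σ, hA, fun v => ?_⟩
  rw [← e, hT, LinearEquiv.symm_apply_apply]

/-! ### Extension of scalars -/

variable (K : Type*) [Field K] [Algebra F K]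

theorem IsNormalizing.baseChange (h : IsNormalizing C s) : IsNormalizing (C.baseChange K) s :=
  ⟨h.simple, h.opp, h.c_eq⟩

theorem toTensor_extend (v : C.g₁) : (C.baseChange K).toTensor s (C.extend K v) =
    fun n => algebraMap F K (C.toTensor s v n) := by
  have e : C.extend K v = ((C.baseChange K).toTensor s).symm
      fun n => algebraMap F K (C.toTensor s v n) := by
    apply Subtype.ext
    refine Eq.trans ?_ ((C.baseChange K).coe_eq_sum s _).symm
    rw [LinearEquiv.apply_symm_apply]
    change (1 : K) ⊗ₜ[F] (v : L) = _
    rw [C.coe_eq_sum s v, TensorProduct.tmul_sum]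
    refine Finset.sum_congr rfl fun n _ => ?_
    have : (C.baseChange K).y s (root n) = (1 : K) ⊗ₜ[F] C.y s (root n) := by
      rw [y_eq, y_eq, TensorProduct.tmul_smul, Int.cast_smul_eq_zsmul, Int.cast_smul_eq_zsmul]
      congr 1
      exact C.basis.baseChange_apply K _
    rw [this, TensorProduct.tmul_smul, algebraMap_smul]
  rw [e, LinearEquiv.apply_symm_apply]

theorem hyperdet_map (v : (Outer → Fin 2) → F) :
    hyperdet (fun n => algebraMap F K (v n)) = algebraMap F K (hyperdet v) := by
  simp [hyperdet, map_ofNat]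

theorem symp_map (v w : (Outer → Fin 2) → F) :
    symp (fun n => algebraMap F K (v n)) (fun n => algebraMap F K (w n)) =
      algebraMap F K (symp v w) := by
  simp [symp]

theorem tensorMap_mul_permMap_map (A : Outer → Matrix (Fin 2) (Fin 2) F) (σ : Equiv.Perm Outer)
    (v : (Outer → Fin 2) → F) :
    (tensorMap (fun i => (A i).map (algebraMap F K)) * permMap K σ)
        (fun n => algebraMap F K (v n)) =
      fun n => algebraMap F K ((tensorMap A * permMap F σ) v n) := by
  funext n
  simp only [Module.End.mul_apply, tensorMap_apply, permMap_apply, Matrix.map_apply, map_sum,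
    map_mul, map_prod]

end

end ChevalleyBasisD4

/-! ### The stabilizer -/

theorem mainTheorem5 {F L : Type*} [Field F] (hF2 : ringChar F ≠ 2) (hF3 : ringChar F ≠ 3)
    [LieRing L] [LieAlgebra F L] (C : ChevalleyBasisD4 F L)
    (K : Type*) [Field K] [Algebra F K] [IsAlgClosed K] :
    ∃ Φ : ChevalleyBasisD4.SL2CubedS3 K →*
        ((C.baseChange K).g₁ ≃ₗ[K] (C.baseChange K).g₁),
      (C.baseChange K).IsNaturalAction Φ ∧
      -- the kernel
      (∀ s, Φ s = 1 ↔ s.right = 1 ∧ ∃ ε : ChevalleyBasisD4.Outer → ℤˣ,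
        ∏ i, ε i = 1 ∧ ∀ i, (s.left i : Matrix (Fin 2) (Fin 2) K) = ((ε i : ℤ) : K) • 1) ∧
      -- the stabilizer over the algebraically closed field `K`
      (C.baseChange K).stab = Φ.range ∧
      -- the stabilizer over `F`
      (∀ g : C.g₁ ≃ₗ[F] C.g₁, g ∈ C.stab ↔
        ∃ s, ∀ v : C.g₁, Φ s (C.extend K v) = C.extend K (g v)) := by
  have h2 : (2 : F) ≠ 0 := Ring.two_ne_zero hF2
  have h3 : (3 : F) ≠ 0 := fun e => hF3 <|
    (Nat.prime_three.eq_one_or_self_of_dvd _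
      ((ringChar.spec F 3).1 (by exact_mod_cast e))).resolve_left CharP.ringChar_ne_one
  have h6 : (6 : F) ≠ 0 := by
    rw [show (6 : F) = 2 * 3 by norm_num]
    exact mul_ne_zero h2 h3
  have h2K : (2 : K) ≠ 0 := by
    simpa only [map_ofNat] using (map_ne_zero (algebraMap F K)).2 h2
  have h6K : (6 : K) ≠ 0 := by
    simpa only [map_ofNat] using (map_ne_zero (algebraMap F K)).2 h6
  obtain ⟨s, hs1, hs2, hs3⟩ := C.exists_sign h2
  have h : C.IsNormalizing s := ⟨hs1, hs2, hs3⟩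
  have hK := h.baseChange K
  have hinj : Function.Injective (algebraMap F K) := (algebraMap F K).injective
  refine ⟨(C.baseChange K).naturalAction s, hK.isNaturalAction, fun g => ?_, ?_, fun g => ⟨?_, ?_⟩⟩
  · rw [ChevalleyBasisD4.naturalAction_eq_one_iff, ChevalleyBasisD4.tensorAction_eq_one_iff]
  · ext g
    constructor
    · intro hg
      obtain ⟨A, σ, hA, e⟩ := hK.exists_of_mem_stab h2K h6K hg
      obtain ⟨t, ht⟩ := ChevalleyBasisD4.exists_tensorAction_eq A hA σ
      refine ⟨t, LinearEquiv.ext fun v => ((C.baseChange K).toTensor s).injective ?_⟩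
      rw [ChevalleyBasisD4.toTensor_naturalAction, ht, e]
    · rintro ⟨t, rfl⟩
      exact hK.naturalAction_mem_stab h6K t
  · intro hg
    -- the decomposition is taken over `F`, and its matrices are extended to `K`
    obtain ⟨A, σ, hA, e⟩ := h.exists_of_mem_stab h2 h6 hg
    obtain ⟨t, ht⟩ := ChevalleyBasisD4.exists_tensorAction_eq
      (fun i => (A i).map (algebraMap F K)) (by
        rw [← map_one (algebraMap F K), ← hA, map_prod]
        exact Finset.prod_congr rfl fun i _ => ((algebraMap F K).map_det (A i)).symm) σ
    refine ⟨t, fun v => ((C.baseChange K).toTensor s).injective ?_⟩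
    rw [ChevalleyBasisD4.toTensor_naturalAction, ht, ChevalleyBasisD4.toTensor_extend,
      ChevalleyBasisD4.toTensor_extend, ChevalleyBasisD4.tensorMap_mul_permMap_map, e]
  · rintro ⟨t, ht⟩
    have ht' : ∀ v, ChevalleyBasisD4.tensorAction K t
        (fun n => algebraMap F K (C.toTensor s v n)) =
          fun n => algebraMap F K (C.toTensor s (g v) n) := fun v => by
      rw [← ChevalleyBasisD4.toTensor_extend, ← ChevalleyBasisD4.toTensor_extend, ← ht,
        ChevalleyBasisD4.toTensor_naturalAction]
    rw [h.mem_stab_iff h6]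
    refine ⟨fun v => hinj ?_, fun v w => hinj ?_⟩
    · rw [← ChevalleyBasisD4.hyperdet_map, ← ht', ChevalleyBasisD4.hyperdet_tensorAction,
        ChevalleyBasisD4.hyperdet_map]
    · rw [← ChevalleyBasisD4.symp_map, ← ht', ← ht', ChevalleyBasisD4.symp_tensorAction,
        ChevalleyBasisD4.symp_map]
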